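/- **Setting.** *MPC model.* $M$ machines compute in synchronous rounds. A machine's memory is a sequence of words. In each round every machine performs an arbitrary local computation on its memory and exchanges messages with the other machines. With local memory bound $S$, every machine stores, sends and receives at most $S$ words of $O(\log n)$ bits in every round. *Rooted tree.* $T$ is a rooted tree whose vertices have distinct identifiers in $\{0,\dots,n-1\}$ (it may be one component of a forest on $n$ vertices), with a label on each edge. For a vertex $v$, $E_v$ is the set of labelled edges of the subtree of $T$ rooted in $v$, that is, of the edges both of whose endpoints are descendants of $v$ (with $v$ a descendant of itself). *Distributive aggregative function.* A function $f$ of sets of labelled edges is distributive aggregative if there are functions $f',g,g'$ with $f'(E_1\cup E_2)=g(f'(E_1),f'(E_2))$ for any two disjoint non-empty sets $E_1,E_2$ of edges with labels, and $f(E)=g'(f'(E))$ for every non-empty $E$. The value $f(\emptyset)$ is arbitrary. Labels, the values of $f'$ on non-empty edge sets, and the values of $f$ are represented faithfully by $k$ words each. *Top tree.* For $\alpha\in(0,1)$ and a constant $c$, a (balanced) top tree of $T$ is a rooted tree of nodes, each representing a connected set of edges of $T$ (its cluster), such that - the nodes of rank $0$ correspond to the single edges of $T$, and all children of a node of rank $r>0$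 have rank $r-1$; - the cluster of a node of positive rank is the union of the clusters of its children; - every node of positive rank has at least $2$ and at most $c\,n^{\alpha/2}$ children, and at least $n^{\alpha/2}$ of them unless it represents all of $T$. There is a single parentless node (none if $T$ has no edge). The root of a node is the vertex of its cluster closest to the root of $T$. A boundary vertex of a node is a vertex incident both to an edge of its cluster and to an edge of $T$ outside it. Each vertex $v$ has a reference set, which contains exactly one node of each rank at which some node contains $v$, and that node contains $v$. *Storage.* Each node, and each vertex of $T$, is stored on some machine. A node's description consists of its name, rank, pointers to its parent and children (machine and name), its root, its boundary vertices, the boundary vertices of each child, for a rank-$0$ node its edge with the label, and the reference sets of all vertices it stores. A vertex is stored with its reference set. The placement on machines and the order of the records on a machine are arbitrary, provided that every machine holds at most $B\,n^{\alpha}$ words, all smaller than $(n+1)^d$. **Lemma (subtree aggregation).** There is an absolute constant $C$ such that for all constants $c\in\mathbb R$ and $B,k,d\in\mathbb N$ there is a constant $D$ with the following property. Let $\alpha\in(0,1)$, let $n,M$ be natural numbers, and let $f$ be a distributive aggregative function of labelled edge sets on $\{0,\dots,n-1\}$, with labels, values of $f'$ and values of $f$ represented by $k$ words smaller than $(n+1)^d$.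 Then there is a deterministic MPC algorithm for $M$ machines, with at most $C/\alpha$ rounds, that works for every edge-labelled rooted tree $T$ as above and every top tree of $T$ stored as above on the $M$ machines: started from the stored data structure it uses local memory at most $D\,n^{\alpha}$, in words smaller than $(n+1)^{D}$, and at the end the machines hold exactly the pairs $(v,f(E_v))$ for the vertices $v$ of $T$, distributed over the machines. -/

import Mathlib

/-! ### Rooted trees -/

/-- A rooted tree whose vertices carry identifiers in `Fin n`: an acyclic graph all of whose edges
lie in the connected component of `root`.  Identifiers that are not reachable from `root` are not
vertices of the tree, so the tree may be one component of a forest on `n` vertices. -/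
structure RootedTreeOn (n : ℕ) where
  graph : SimpleGraph (Fin n)
  root : Fin n
  acyclic : graph.IsAcyclic
  reachable : ∀ u v, graph.Adj u v → graph.Reachable root u

namespace RootedTreeOn

variable {n : ℕ} (T : RootedTreeOn n)

/-- `v` is a vertex of the tree. -/
def IsVertex (v : Fin n) : Prop := T.graph.Reachable T.root v

/-- The edges of the tree. -/
noncomputable def edges : Finset (Sym2 (Fin n)) := (Set.toFinite T.graph.edgeSet).toFinset

/-- `v` is an ancestor of `u` (possibly `v = u`): `v` lies on the path from the root to `u`. -/
def IsAncestor (v u : Fin n) : Prop :=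
  ∃ p : T.graph.Walk T.root u, p.IsPath ∧ v ∈ p.support

/-- The edges of the subtree rooted in `v`: those edges both of whose endpoints descend from `v`. -/
noncomputable def subtreeEdges (v : Fin n) : Finset (Sym2 (Fin n)) :=
  (Set.toFinite {e | e ∈ T.graph.edgeSet ∧ ∀ u ∈ e, T.IsAncestor v u}).toFinset

end RootedTreeOn

/-! ### Distributive aggregative functions of labelled edge sets -/

/-- The set of labelled edges obtained by attaching to each edge of `E` its label under `l`. -/
def labelled {n : ℕ} {Λ : Type*} (l : Sym2 (Fin n) → Λ) (E : Finset (Sym2 (Fin n))) :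
    Finset (Sym2 (Fin n) × Λ) :=
  E.map ⟨fun e => (e, l e), fun _ _ h => (Prod.mk.inj h).1⟩

/-- A finite set of (non-loop) edges. -/
def IsEdgeSet {n : ℕ} (E : Finset (Sym2 (Fin n))) : Prop := ∀ e ∈ E, ¬ e.IsDiag

/-- `f', g, g'` witness that the function `f` of labelled edge sets is distributive aggregative:
`f' (E₁ ∪ E₂) = g (f' E₁) (f' E₂)` for disjoint edge sets and `f = g' ∘ f'`.  Nothing is required
of the empty set, so that for example a maximum is allowed; `f ∅` is an arbitrary value. -/
structure IsDistributiveAggregative {n : ℕ} {Λ β γ : Type*}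
    (f : Finset (Sym2 (Fin n) × Λ) → γ) (f' : Finset (Sym2 (Fin n) × Λ) → β)
    (g : β → β → β) (g' : β → γ) : Prop where
  union : ∀ (l : Sym2 (Fin n) → Λ) (E₁ E₂ : Finset (Sym2 (Fin n))),
    IsEdgeSet E₁ → IsEdgeSet E₂ → E₁.Nonempty → E₂.Nonempty → Disjoint E₁ E₂ →
      f' (labelled l (E₁ ∪ E₂)) = g (f' (labelled l E₁)) (f' (labelled l E₂))
  value : ∀ (l : Sym2 (Fin n) → Λ) (E : Finset (Sym2 (Fin n))),
    IsEdgeSet E → E.Nonempty → f (labelled l E) = g' (f' (labelled l E))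

/-- `enc` represents each element of `s` faithfully by `k` machine words smaller than `W`. -/
structure IsWordCode {β : Type*} (enc : β → List ℕ) (s : Set β) (k W : ℕ) : Prop where
  injOn : Set.InjOn enc s
  length : ∀ x ∈ s, (enc x).length = k
  lt : ∀ x ∈ s, ∀ w ∈ enc x, w < W

/-! ### Top trees -/

/-- The vertices that are incident to an edge of `E`. -/
def edgeVerts {n : ℕ} (E : Finset (Sym2 (Fin n))) : Set (Fin n) := {v | ∃ e ∈ E, v ∈ e}

/-- `E` is a connected set of edges. -/
def EdgeConnected {n : ℕ} (E : Finset (Sym2 (Fin n))) : Prop :=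
  ∀ u ∈ edgeVerts E, ∀ v ∈ edgeVerts E,
    (SimpleGraph.fromEdgeSet (E : Set (Sym2 (Fin n)))).Reachable u v

/-- A balanced top tree of the underlying tree `T`, with arity parameter `n ^ (α / 2)` and
balance constant `c`.  Its nodes are named by `Fin N`. -/
structure TopTree {n : ℕ} (T : RootedTreeOn n) (α c : ℝ) where
  N : ℕ
  rank : Fin N → ℕ
  parent : Fin N → Option (Fin N)
  /-- the cluster of the underlying tree represented by a node -/
  cluster : Fin N → Finset (Sym2 (Fin n))
  /-- the root vertex of a node -/
  root : Fin N → Fin n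
  /-- the reference set of a vertex -/
  ref : Fin n → Finset (Fin N)
  /-- the nodes of rank `0` are the edges of the underlying tree -/
  leaf_cluster : ∀ X, rank X = 0 → ∃ e ∈ T.edges, cluster X = {e}
  leaf_unique : ∀ e ∈ T.edges, ∃! X, rank X = 0 ∧ cluster X = {e}
  rank_parent : ∀ X Y, parent Y = some X → rank X = rank Y + 1
  /-- there is at most one node without a parent -/
  top_unique : ∀ X Y, parent X = none → parent Y = none → X = Y
  /-- an inner node represents the union of the clusters of its children -/
  cluster_eq : ∀ X, 0 < rank X → ∀ e, e ∈ cluster X ↔ ∃ Y, parent Y = some X ∧ e ∈ cluster Y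
  cluster_connected : ∀ X, EdgeConnected (cluster X)
  two_le_children : ∀ X, 0 < rank X → 2 ≤ (Finset.univ.filter fun Y => parent Y = some X).card
  children_le : ∀ X, 0 < rank X →
    ((Finset.univ.filter fun Y => parent Y = some X).card : ℝ) ≤ c * (n : ℝ) ^ (α / 2)
  le_children : ∀ X, 0 < rank X → cluster X ≠ T.edges →
    (n : ℝ) ^ (α / 2) ≤ ((Finset.univ.filter fun Y => parent Y = some X).card : ℝ)
  /-- the root of a node is the vertex of its cluster that is closest to the root of `T` -/
  root_mem : ∀ X, root X ∈ edgeVerts (cluster X)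
  root_ancestor : ∀ X, ∀ v ∈ edgeVerts (cluster X), T.IsAncestor (root X) v
  /-- the reference set of a vertex holds one node per rank that contains this vertex -/
  ref_mem : ∀ v, ∀ X ∈ ref v, v ∈ edgeVerts (cluster X)
  ref_unique : ∀ v X, v ∈ edgeVerts (cluster X) → ∃! Y, Y ∈ ref v ∧ rank Y = rank X

namespace TopTree

variable {n : ℕ} {T : RootedTreeOn n} {α c : ℝ} (τ : TopTree T α c)

/-- `v` is a boundary vertex of the node `X`: it is shared by the cluster of `X` and an edge of the
underlying tree outside that cluster. -/
def IsBoundary (X : Fin τ.N) (v : Fin n) : Prop :=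
  v ∈ edgeVerts (τ.cluster X) ∧ ∃ e ∈ T.edges, e ∉ τ.cluster X ∧ v ∈ e

/-- The vertices of the underlying tree that are stored by the node `X`: its root, its boundary
vertices, the boundary vertices of its children and, at rank `0`, the endpoints of its edge. -/
def StoresVertex (X : Fin τ.N) (v : Fin n) : Prop :=
  v = τ.root X ∨ τ.IsBoundary X v ∨ (∃ Y, τ.parent Y = some X ∧ τ.IsBoundary Y v) ∨
    (τ.rank X = 0 ∧ v ∈ edgeVerts (τ.cluster X))

/-- The records kept by machine `i` when the description of each node `X` is stored on the machine
`home X` and that of each vertex `v` on the machine `vhome v`.  The first word of a record is its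
kind; a pointer to a node consists of its machine and its name. -/
inductive IsRecord {M : ℕ} {Λ : Type*} (l : Sym2 (Fin n) → Λ) (encL : Λ → List ℕ)
    (home : Fin τ.N → Fin M) (vhome : Fin n → Fin M) (i : Fin M) : List ℕ → Prop
  | rank (X : Fin τ.N) : home X = i → IsRecord l encL home vhome i [0, X, τ.rank X]
  | parent (X P : Fin τ.N) : home X = i → τ.parent X = some P →
      IsRecord l encL home vhome i [1, X, home P, P]
  | root (X : Fin τ.N) : home X = i → IsRecord l encL home vhome i [2, X, τ.root X]
  | boundary (X : Fin τ.N) (v : Fin n) : home X = i → τ.IsBoundary X v →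
      IsRecord l encL home vhome i [3, X, v]
  | child (X Y : Fin τ.N) : home X = i → τ.parent Y = some X →
      IsRecord l encL home vhome i [4, X, home Y, Y]
  | childBoundary (X Y : Fin τ.N) (v : Fin n) : home X = i → τ.parent Y = some X →
      τ.IsBoundary Y v → IsRecord l encL home vhome i [5, X, Y, v]
  | edge (X : Fin τ.N) (u v : Fin n) : home X = i → τ.rank X = 0 → τ.cluster X = {s(u, v)} →
      IsRecord l encL home vhome i (6 :: (X : ℕ) :: (u : ℕ) :: (v : ℕ) :: encL (l s(u, v)))
  | nodeRef (X Z : Fin τ.N) (v : Fin n) : home X = i → τ.StoresVertex X v → Z ∈ τ.ref v →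
      IsRecord l encL home vhome i [7, X, v, home Z, Z]
  | vertex (v : Fin n) : vhome v = i → T.IsVertex v → IsRecord l encL home vhome i [8, v]
  | vertexRef (v : Fin n) (Z : Fin τ.N) : vhome v = i → T.IsVertex v → Z ∈ τ.ref v →
      IsRecord l encL home vhome i [9, v, home Z, Z]

end TopTree

/-- A list of records written down as one sequence of words, each record preceded by its length. -/
def flatRecords (L : List (List ℕ)) : List ℕ := L.flatMap fun r => r.length :: r

/-- The memories `m` of the machines hold exactly the top tree data structure `τ` of the tree `T`
with edge labels `l`, each machine keeping its records in an arbitrary order. -/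
def StoresTopTree {n : ℕ} {T : RootedTreeOn n} {α c : ℝ} (τ : TopTree T α c) {M : ℕ} {Λ : Type*}
    (l : Sym2 (Fin n) → Λ) (encL : Λ → List ℕ) (home : Fin τ.N → Fin M) (vhome : Fin n → Fin M)
    (m : Fin M → List ℕ) : Prop :=
  ∀ i, ∃ L : List (List ℕ), L.Nodup ∧ (∀ r, r ∈ L ↔ τ.IsRecord l encL home vhome i r) ∧
    m i = flatRecords L

/-! ### The MPC model -/

/-- An algorithm for `M` machines that communicate in synchronous rounds.  The memory of a machine
is a list of words.  In round `t`, machine `i` with memory `m` sends the words `send t i m j` to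
machine `j`, and then replaces its memory by a function of its memory and the received messages. -/
structure MPCAlgorithm (M : ℕ) where
  rounds : ℕ
  send : ℕ → Fin M → List ℕ → Fin M → List ℕ
  update : ℕ → Fin M → List ℕ → (Fin M → List ℕ) → List ℕ

namespace MPCAlgorithm

variable {M : ℕ} (A : MPCAlgorithm M)

/-- The memories of the machines after `t` rounds, starting from the memories `m`. -/
def memory (m : Fin M → List ℕ) : ℕ → Fin M → List ℕ
  | 0 => m
  | t + 1 => fun i => A.update t i (memory m t i) fun j => A.send t j (memory m t j) i

/-- The words that machine `i` sends to machine `j` in round `t` of the run started from `m`. -/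
def message (m : Fin M → List ℕ) (t : ℕ) (i j : Fin M) : List ℕ := A.send t i (A.memory m t i) j

/-- The run started from `m` respects the local memory bound of `S` words smaller than `W`: in
every round each machine stores, sends and receives at most `S` such words. -/
structure Respects (m : Fin M → List ℕ) (S : ℝ) (W : ℕ) : Prop where
  memory_length : ∀ t ≤ A.rounds, ∀ i, ((A.memory m t i).length : ℝ) ≤ S
  memory_lt : ∀ t ≤ A.rounds, ∀ i, ∀ w ∈ A.memory m t i, w < W
  message_lt : ∀ t < A.rounds, ∀ i j, ∀ w ∈ A.message m t i j, w < W
  sent_le : ∀ t < A.rounds, ∀ i, ((∑ j, (A.message m t i j).length : ℕ) : ℝ) ≤ S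
  received_le : ∀ t < A.rounds, ∀ i, ((∑ j, (A.message m t j i).length : ℕ) : ℝ) ≤ S

/-- At the end of the run started from `m`, the machines hold exactly the pairs `(v, val v)` for
the identifiers `v` with `P v`, distributed in some way: every such pair is known to some machine,
and every record of a machine is such a pair. -/
def Outputs {n : ℕ} (m : Fin M → List ℕ) (P : Fin n → Prop) (val : Fin n → List ℕ) : Prop :=
  ∃ O : Fin M → List (List ℕ),
    (∀ i, A.memory m A.rounds i = flatRecords (O i)) ∧
    (∀ v, P v → ∃ i, ((v : ℕ) :: val v) ∈ O i) ∧
    (∀ i, ∀ r ∈ O i, ∃ v, P v ∧ r = (v : ℕ) :: val v)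

end MPCAlgorithm

/-! A cluster touches the rest of the tree only at its portals, that is, its root and its boundary
vertices. Every edge of the cluster of a node `X` hangs off the lowest portal above its upper
endpoint, which cuts the cluster into the sets `hang X b`. The portals of the children of `X` (the
hubs of `X`) cut it more finely into pieces `hang Y q`.

The decisive fact is `Hub.isAncestor_top_iff`: a hub lies above an edge of the piece `hang Y q`
exactly if it lies above `q`. So each piece behaves like a single point in the ancestor order of the
hubs. It follows that `hang X b` is a disjoint union of pieces (`mem_hang_iff`), and that the
subtree edges of a hub `q` are a disjoint union of pieces and of the subtrees of the highest portals
of `X` below `q` (`mem_subtreeEdges_iff`). Which sets enter these unions depends only on the order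
of the hubs, and `f'` of a disjoint union is computed by `g`.

This gives two sweeps. Going up, a node tells its parent the values of its sets `hang X b` and the
order of its portals. Going down, a node tells each child the values of the full subtrees of the
child's portals. The leaves then know the answers for the endpoints of their edges. A node of rank
`r` with a parent has at least `n ^ (α r / 2)` edges, so ranks are at most `⌊2 / α⌋ + 1` (`rank_le`)
and the sweeps take `O(1 / α)` rounds.

For the memory bound, a full order relation could be quadratic in the number of portals. Only its
covering relation is sent: ancestors of a vertex form a chain, so every portal covers at most one
other (`Cov.unique`), and the parent recovers the order of its hubs as the reflexive transitive
closure (`Hub.reflTransGen_cov`). Every record that is ever held or sent is then determined by its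
kind and one initial record of the same machine, so memory grows by a constant factor only
(`ncard_known_le`, `ncard_sent_le`, `ncard_final_le`). -/

namespace RootedTreeOn

/-! ### Parents, ancestors and edge orientation in a rooted tree -/

variable {n : ℕ} (T : RootedTreeOn n)

/-- `u` is the parent of `v` in the rooted tree. -/
def Par (u v : Fin n) : Prop :=
  T.graph.Adj u v ∧ T.graph.dist T.root v = T.graph.dist T.root u + 1

variable {T}

theorem path_eq {u : Fin n} {p q : T.graph.Walk T.root u} (hp : p.IsPath) (hq : q.IsPath) :
    p = q :=
  congrArg Subtype.val ((T.acyclic.subsingleton_path _ _).elim ⟨p, hp⟩ ⟨q, hq⟩)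

theorem length_path {u : Fin n} {p : T.graph.Walk T.root u} (hp : p.IsPath) :
    p.length = T.graph.dist T.root u := by
  obtain ⟨q, hq, h⟩ := p.reachable.exists_path_of_dist
  rw [path_eq hp hq, h]

theorem Par.isVertex_left {u v : Fin n} (h : T.Par u v) : T.IsVertex u := T.reachable u v h.1

theorem Par.isVertex_right {u v : Fin n} (h : T.Par u v) : T.IsVertex v :=
  T.reachable v u h.1.symm

/-- Take the path from the root to `u`. If it avoids `v`, it extends to the path to `v`; otherwise
its part up to `v`, extended by `u`, is a path to `u`. Uniqueness of paths turns lengths into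
distances. -/
theorem par_or_par {u v : Fin n} (h : T.graph.Adj u v) : T.Par u v ∨ T.Par v u := by
  obtain ⟨p, hp, hl⟩ := (T.reachable u v h).exists_path_of_dist
  by_cases hv : v ∈ p.support
  · right
    have hu := SimpleGraph.Walk.endpoint_notMem_support_takeUntil hp hv h.ne
    have hq := (hp.takeUntil hv).concat hu h.symm
    refine ⟨h.symm, ?_⟩
    rw [← length_path hq, ← length_path (hp.takeUntil hv), SimpleGraph.Walk.length_concat]
  · left
    have hq := hp.concat hv h
    exact ⟨h, by rw [← length_path hq, ← length_path hp, SimpleGraph.Walk.length_concat]⟩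

/-- The path to `v` is the path to its parent with `v` appended. This recursion replaces paths in
all later arguments about ancestors. -/
theorem Par.isAncestor_iff {u v w : Fin n} (h : T.Par u v) :
    T.IsAncestor w v ↔ w = v ∨ T.IsAncestor w u := by
  obtain ⟨p, hp, hl⟩ := h.isVertex_left.exists_path_of_dist
  have hv : v ∉ p.support := by
    intro hv
    have := length_path (hp.takeUntil hv)
    have := p.length_takeUntil_le_length hv
    have := h.2
    omega
  have hq := hp.concat hv h.1
  constructor
  · rintro ⟨r, hr, hw⟩
    rw [path_eq hr hq, SimpleGraph.Walk.support_concat] at hw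
    simp only [List.mem_append, List.mem_singleton] at hw
    exact hw.elim (fun h => Or.inr ⟨p, hp, h⟩) Or.inl
  · rintro (rfl | ⟨r, hr, hw⟩)
    · exact ⟨_, hq, SimpleGraph.Walk.end_mem_support _⟩
    · rw [path_eq hr hp] at hw
      exact ⟨_, hq, by rw [SimpleGraph.Walk.support_concat]; simp [hw]⟩

theorem isAncestor_root_iff {w : Fin n} : T.IsAncestor w T.root ↔ w = T.root := by
  constructor
  · rintro ⟨r, hr, hw⟩
    rw [path_eq hr SimpleGraph.Walk.IsPath.nil] at hw
    simpa using hw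
  · rintro rfl
    exact ⟨_, SimpleGraph.Walk.IsPath.nil, by simp⟩

theorem isAncestor_refl {v : Fin n} (h : T.IsVertex v) : T.IsAncestor v v := by
  obtain ⟨p, hp, -⟩ := h.exists_path_of_dist
  exact ⟨p, hp, p.end_mem_support⟩

theorem IsAncestor.isVertex_right {v w : Fin n} (h : T.IsAncestor v w) : T.IsVertex w := by
  obtain ⟨p, -, -⟩ := h
  exact p.reachable

theorem exists_par {v : Fin n} (h : T.IsVertex v) (hv : v ≠ T.root) : ∃ u, T.Par u v := by
  obtain ⟨p, hp, hl⟩ := h.exists_path_of_dist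
  have hn : ¬ p.Nil := fun hn => hv hn.eq.symm
  have ha := p.adj_penultimate hn
  rcases par_or_par ha with h | h
  · exact ⟨_, h⟩
  · exfalso
    have h1 := length_path hp.dropLast
    have h2 := h.2
    have h3 := p.length_dropLast_add_one hn
    omega

/-- Induction along the ancestors of a vertex. -/
theorem vertex_induction {P : Fin n → Prop} (root : P T.root)
    (step : ∀ u v, T.Par u v → P u → P v) (v : Fin n) (hv : T.IsVertex v) : P v := by
  induction hd : T.graph.dist T.root v generalizing v with
  | zero =>
    by_cases h : v = T.root
    · exact h ▸ root
    · obtain ⟨u, hu⟩ := exists_par hv h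
      have := hu.2
      omega
  | succ k ih =>
    by_cases h : v = T.root
    · exact h ▸ root
    · obtain ⟨u, hu⟩ := exists_par hv h
      exact step u v hu (ih u hu.isVertex_left (by have := hu.2; omega))

theorem root_isAncestor {v : Fin n} (h : T.IsVertex v) : T.IsAncestor T.root v :=
  vertex_induction (P := fun v => T.IsAncestor T.root v) (isAncestor_root_iff.2 rfl)
    (fun _ _ h ih => h.isAncestor_iff.2 (Or.inr ih)) v h

theorem IsAncestor.isVertex_left {v w : Fin n} (h : T.IsAncestor v w) : T.IsVertex v := by
  obtain ⟨p, -, h⟩ := h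
  exact (p.takeUntil v h).reachable

theorem IsAncestor.trans {a b c : Fin n} (hab : T.IsAncestor a b) (hbc : T.IsAncestor b c) :
    T.IsAncestor a c := by
  refine vertex_induction (P := fun c => T.IsAncestor b c → T.IsAncestor a c) ?_ ?_ c
    hbc.isVertex_right hbc
  · intro h
    rwa [← isAncestor_root_iff.1 h]
  · intro u v huv ih h
    rcases huv.isAncestor_iff.1 h with rfl | h
    · exact hab
    · exact huv.isAncestor_iff.2 (Or.inr (ih h))

theorem IsAncestor.dist_le {a b : Fin n} (h : T.IsAncestor a b) :
    a = b ∨ T.graph.dist T.root a < T.graph.dist T.root b := by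
  refine vertex_induction
    (P := fun b => T.IsAncestor a b → a = b ∨ T.graph.dist T.root a < T.graph.dist T.root b)
    ?_ ?_ b h.isVertex_right h
  · intro h
    exact Or.inl (isAncestor_root_iff.1 h)
  · intro u v huv ih h
    rcases huv.isAncestor_iff.1 h with rfl | h
    · exact Or.inl rfl
    · have := huv.2
      rcases ih h with rfl | h <;> right <;> omega

theorem IsAncestor.antisymm {a b : Fin n} (h : T.IsAncestor a b) (h' : T.IsAncestor b a) :
    a = b := by
  rcases h.dist_le with h | h
  · exact h
  · rcases h'.dist_le with h' | h'
    · exact h'.symm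
    · omega

/-- The ancestors of a vertex form a chain. -/
theorem IsAncestor.total {a b c : Fin n} (ha : T.IsAncestor a c) (hb : T.IsAncestor b c) :
    T.IsAncestor a b ∨ T.IsAncestor b a := by
  refine vertex_induction (P := fun c => T.IsAncestor a c → T.IsAncestor b c →
    T.IsAncestor a b ∨ T.IsAncestor b a) ?_ ?_ c ha.isVertex_right ha hb
  · intro h h'
    rw [isAncestor_root_iff.1 h]
    exact Or.inl (root_isAncestor h'.isVertex_left)
  · intro u v huv ih h h'
    rcases huv.isAncestor_iff.1 h with rfl | h1
    · exact Or.inr h'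
    · rcases huv.isAncestor_iff.1 h' with rfl | h2
      · exact Or.inl h
      · exact ih h1 h2

theorem Par.isAncestor {u v : Fin n} (h : T.Par u v) : T.IsAncestor u v :=
  h.isAncestor_iff.2 (Or.inr (isAncestor_refl h.isVertex_left))

theorem Par.not_isAncestor {u v : Fin n} (h : T.Par u v) : ¬ T.IsAncestor v u :=
  fun h' => h.1.ne (h.isAncestor.antisymm h')

theorem Par.eq {u u' v : Fin n} (h : T.Par u v) (h' : T.Par u' v) : u = u' := by
  have h1 := (h'.isAncestor_iff.1 h.isAncestor).resolve_left h.1.ne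
  have h2 := (h.isAncestor_iff.1 h'.isAncestor).resolve_left h'.1.ne
  exact h1.antisymm h2

theorem mem_edges {e : Sym2 (Fin n)} : e ∈ T.edges ↔ e ∈ T.graph.edgeSet := by
  simp [edges]

theorem exists_ends {e : Sym2 (Fin n)} (he : e ∈ T.edges) : ∃ p : Fin n × Fin n,
    e = s(p.1, p.2) ∧ T.Par p.1 p.2 := by
  rw [mem_edges] at he
  induction e with
  | _ u v =>
    rcases par_or_par (T.graph.mem_edgeSet.1 he) with h | h
    · exact ⟨(u, v), rfl, h⟩
    · exact ⟨(v, u), Sym2.eq_swap, h⟩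

open Classical in
/-- The two endpoints of an edge, the upper one first. -/
noncomputable def ends (T : RootedTreeOn n) (e : Sym2 (Fin n)) : Fin n × Fin n :=
  if he : e ∈ T.edges then (exists_ends he).choose else (T.root, T.root)

/-- The endpoint of an edge that is closer to the root. -/
noncomputable abbrev top (T : RootedTreeOn n) (e : Sym2 (Fin n)) : Fin n := (T.ends e).1

/-- The endpoint of an edge that is farther from the root. -/
noncomputable abbrev bot (T : RootedTreeOn n) (e : Sym2 (Fin n)) : Fin n := (T.ends e).2

theorem ends_spec {e : Sym2 (Fin n)} (he : e ∈ T.edges) :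
    e = s(T.top e, T.bot e) ∧ T.Par (T.top e) (T.bot e) := by
  simp only [top, bot, ends, dif_pos he]
  exact (exists_ends he).choose_spec

theorem par_ends {e : Sym2 (Fin n)} (he : e ∈ T.edges) : T.Par (T.top e) (T.bot e) :=
  (ends_spec he).2

theorem mem_edge_iff {e : Sym2 (Fin n)} (he : e ∈ T.edges) {v : Fin n} :
    v ∈ e ↔ v = T.top e ∨ v = T.bot e := by
  conv_lhs => rw [(ends_spec he).1]
  exact Sym2.mem_iff

theorem top_mem {e : Sym2 (Fin n)} (he : e ∈ T.edges) : T.top e ∈ e := (mem_edge_iff he).2 (Or.inl rfl)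

theorem bot_mem {e : Sym2 (Fin n)} (he : e ∈ T.edges) : T.bot e ∈ e := (mem_edge_iff he).2 (Or.inr rfl)

theorem Par.mem_edges {u v : Fin n} (h : T.Par u v) : s(u, v) ∈ T.edges :=
  RootedTreeOn.mem_edges.2 h.1

theorem Par.top_eq {u v : Fin n} (h : T.Par u v) : T.top s(u, v) = u ∧ T.bot s(u, v) = v := by
  have h1 := ends_spec h.mem_edges
  rcases Sym2.eq_iff.1 h1.1 with ⟨h2, h3⟩ | ⟨h2, h3⟩
  · exact ⟨h2.symm, h3.symm⟩
  · have := h1.2.2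
    rw [← h2, ← h3] at this
    have := h.2
    omega

theorem eq_of_bot_eq {e e' : Sym2 (Fin n)} (he : e ∈ T.edges) (he' : e' ∈ T.edges)
    (h : T.bot e = T.bot e') : e = e' := by
  have h1 := ends_spec he
  have h2 := ends_spec he'
  have ht : T.top e = T.top e' := (h ▸ h1.2 : T.Par (T.top e) (T.bot e')).eq h2.2
  exact h1.1.trans (by rw [ht, h, ← h2.1])

theorem isVertex_of_mem {e : Sym2 (Fin n)} (he : e ∈ T.edges) {v : Fin n} (hv : v ∈ e) :
    T.IsVertex v := by
  rcases (mem_edge_iff he).1 hv with rfl | rfl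
  · exact (par_ends he).isVertex_left
  · exact (par_ends he).isVertex_right

theorem isEdgeSet_of_subset {E : Finset (Sym2 (Fin n))} (h : E ⊆ T.edges) : IsEdgeSet E :=
  fun _ he => T.graph.not_isDiag_of_mem_edgeSet (mem_edges.1 (h he))

/-- An edge lies in the subtree rooted in `v` when its upper endpoint descends from `v`. -/
theorem mem_subtreeEdges {v : Fin n} {e : Sym2 (Fin n)} :
    e ∈ T.subtreeEdges v ↔ e ∈ T.edges ∧ T.IsAncestor v (T.top e) := by
  simp only [subtreeEdges, Set.Finite.mem_toFinset, Set.mem_ofPred_eq, ← mem_edges]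
  refine and_congr_right fun he => ⟨fun h => h _ (top_mem he), fun h u hu => ?_⟩
  rcases (mem_edge_iff he).1 hu with rfl | rfl
  · exact h
  · exact h.trans (par_ends he).isAncestor

theorem subtreeEdges_subset (v : Fin n) : T.subtreeEdges v ⊆ T.edges :=
  fun _ he => (mem_subtreeEdges.1 he).1

/-- A finite nonempty set of ancestors of a vertex has a lowest element. -/
theorem exists_lowest {P : Fin n → Prop} {a w : Fin n} (ha : P a) (haw : T.IsAncestor a w) :
    ∃ b, P b ∧ T.IsAncestor a b ∧ T.IsAncestor b w ∧
      ∀ c, P c → T.IsAncestor b c → T.IsAncestor c w → c = b := by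
  classical
  obtain ⟨b, hb, hmax⟩ := (Finset.univ.filter fun b => P b ∧ T.IsAncestor a b ∧
    T.IsAncestor b w).exists_max_image (fun b => T.graph.dist T.root b)
    ⟨a, by simp [ha, haw, isAncestor_refl haw.isVertex_left]⟩
  simp only [Finset.mem_filter, Finset.mem_univ, true_and] at hb hmax
  refine ⟨b, hb.1, hb.2.1, hb.2.2, fun c hc hbc hcw => ?_⟩
  have := hmax c ⟨hc, hb.2.1.trans hbc, hcw⟩
  rcases hbc.dist_le with h | h
  · exact h.symm
  · omega

/-- A finite nonempty set of ancestors of a vertex has a highest element. -/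
theorem exists_highest {P : Fin n → Prop} {a w : Fin n} (ha : P a) (haw : T.IsAncestor a w) :
    ∃ b, P b ∧ T.IsAncestor b a ∧ ∀ c, P c → T.IsAncestor c b → c = b := by
  classical
  obtain ⟨b, hb, hmin⟩ := (Finset.univ.filter fun b => P b ∧
    T.IsAncestor b a).exists_min_image (fun b => T.graph.dist T.root b)
    ⟨a, by simp [ha, isAncestor_refl haw.isVertex_left]⟩
  simp only [Finset.mem_filter, Finset.mem_univ, true_and] at hb hmin
  refine ⟨b, hb.1, hb.2, fun c hc hcb => ?_⟩
  have := hmin c ⟨hc, hcb.trans hb.2⟩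
  rcases hcb.dist_le with h | h
  · exact h
  · omega

theorem card_edges_le : T.edges.card ≤ n := by
  have := Finset.card_le_card_of_injOn (s := T.edges) (t := Finset.univ) T.bot (by simp)
    (fun e he e' he' h => eq_of_bot_eq he he' h)
  simpa using this

theorem IsAncestor.exists_edge {v w : Fin n} (h : T.IsAncestor v w)
    (hw : ∃ e ∈ T.edges, w ∈ e) : ∃ e ∈ T.edges, v ∈ e := by
  refine vertex_induction (P := fun w => T.IsAncestor v w → (∃ e ∈ T.edges, w ∈ e) →
    ∃ e ∈ T.edges, v ∈ e) ?_ ?_ w h.isVertex_right h hw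
  · intro h hw
    rwa [isAncestor_root_iff.1 h]
  · intro u w huw ih h hw
    rcases huw.isAncestor_iff.1 h with rfl | h
    · exact hw
    · exact ih h ⟨_, huw.mem_edges, by simp⟩

/-! ### Connected edge sets with a highest vertex -/

section Connected

variable {C : Finset (Sym2 (Fin n))} {r : Fin n}

/-- In a connected edge set with highest vertex `r`, every other vertex comes with its parent
edge. -/
theorem exists_bot_eq (hC : C ⊆ T.edges) (hconn : EdgeConnected C) (hr : r ∈ edgeVerts C)
    (hmin : ∀ v ∈ edgeVerts C, T.IsAncestor r v) {v : Fin n} (hv : v ∈ edgeVerts C)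
    (hvr : v ≠ r) : ∃ e ∈ C, T.bot e = v := by
  -- A walk inside `C` from `v` to `r` must leave the set of descendants of `v`, and the only edge
  -- leaving it is the parent edge of `v`.
  have key : ∀ w, (SimpleGraph.fromEdgeSet (C : Set (Sym2 (Fin n)))).Reachable w r →
      T.IsAncestor v w → ∃ e ∈ C, T.bot e = v := by
    rintro w ⟨p⟩
    induction p with
    | nil => exact fun h => absurd (h.antisymm (hmin v hv)) hvr
    | @cons a b c hab p ih =>
      intro hva
      by_cases hvb : T.IsAncestor v b
      · exact ih hr hmin hvr hvb
      · have habC : s(a, b) ∈ C := by simpa using (SimpleGraph.fromEdgeSet_adj _).1 hab |>.1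
        have hE := hC habC
        refine ⟨s(a, b), habC, ?_⟩
        rcases par_or_par (mem_edges.1 hE) with h | h
        · exact absurd (hva.trans h.isAncestor) hvb
        · rw [Sym2.eq_swap, h.top_eq.2]
          exact ((h.isAncestor_iff.1 hva).resolve_right hvb).symm
  obtain ⟨e, he, hve⟩ := hv
  exact key v (hconn v ⟨e, he, hve⟩ r hr) (isAncestor_refl (isVertex_of_mem (hC he) hve))

/-- A connected edge set contains every vertex between its highest vertex and any of its
vertices. -/
theorem mem_edgeVerts_of_between (hC : C ⊆ T.edges) (hconn : EdgeConnected C)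
    (hr : r ∈ edgeVerts C) (hmin : ∀ v ∈ edgeVerts C, T.IsAncestor r v) {v p : Fin n}
    (hv : v ∈ edgeVerts C) (hrp : T.IsAncestor r p) (hpv : T.IsAncestor p v) :
    p ∈ edgeVerts C := by
  refine vertex_induction (P := fun v => v ∈ edgeVerts C → T.IsAncestor p v → p ∈ edgeVerts C)
    ?_ ?_ v hpv.isVertex_right hv hpv
  · intro h hp
    rwa [isAncestor_root_iff.1 hp]
  · intro u v huv ih hv hpv
    rcases huv.isAncestor_iff.1 hpv with rfl | hpu
    · exact hv
    · by_cases hvr : v = r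
      · exact absurd ((hvr ▸ hrp).trans hpu) huv.not_isAncestor
      · obtain ⟨e, he, rfl⟩ := exists_bot_eq hC hconn hr hmin hv hvr
        refine ih ⟨e, he, ?_⟩ hpu
        rw [huv.eq (par_ends (hC he))]
        exact top_mem (hC he)

/-- Below a vertex of `C`, an edge outside `C` hangs off a vertex that `C` shares with another
edge. -/
theorem exists_boundary {q : Fin n} (hq : q ∈ edgeVerts C) {e : Sym2 (Fin n)} (he : e ∈ T.edges)
    (heC : e ∉ C) (hqe : T.IsAncestor q (T.top e)) :
    ∃ b ∈ edgeVerts C, (∃ e' ∈ T.edges, e' ∉ C ∧ b ∈ e') ∧ T.IsAncestor q b ∧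
      T.IsAncestor b (T.top e) := by
  -- Climb from the edge towards `q`. While the current vertex is outside `C`, its parent edge is
  -- also outside `C`, so the first vertex of `C` that is met carries an edge outside `C`.
  have key : ∀ u, T.IsVertex u → T.IsAncestor q u → (∃ e' ∈ T.edges, e' ∉ C ∧ u ∈ e') →
      ∃ b ∈ edgeVerts C, (∃ e' ∈ T.edges, e' ∉ C ∧ b ∈ e') ∧ T.IsAncestor q b ∧
      T.IsAncestor b u := by
    intro u hu
    refine vertex_induction (P := fun u => T.IsAncestor q u →
      (∃ e' ∈ T.edges, e' ∉ C ∧ u ∈ e') → ∃ b ∈ edgeVerts C,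
      (∃ e' ∈ T.edges, e' ∉ C ∧ b ∈ e') ∧ T.IsAncestor q b ∧ T.IsAncestor b u) ?_ ?_ u hu
    · intro hq' h
      have := isAncestor_root_iff.1 hq'
      subst this
      exact ⟨_, hq, h, hq', hq'⟩
    · intro u v huv ih hqv h
      by_cases hv : v ∈ edgeVerts C
      · exact ⟨v, hv, h, hqv, isAncestor_refl hqv.isVertex_right⟩
      · have hqu := (huv.isAncestor_iff.1 hqv).resolve_left (by rintro rfl; exact hv hq)
        obtain ⟨b, hb, hbe, hqb, hbu⟩ := ih hqu ⟨s(u, v), huv.mem_edges,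
          fun hC => hv ⟨_, hC, by simp⟩, by simp⟩
        exact ⟨b, hb, hbe, hqb, hbu.trans huv.isAncestor⟩
  exact key _ hqe.isVertex_right hqe ⟨e, he, heC, top_mem he⟩

end Connected

end RootedTreeOn

/-! ### Clusters of a top tree and the bound on the ranks -/

namespace TopTree

open RootedTreeOn

variable {n : ℕ} {T : RootedTreeOn n} {α c : ℝ} (τ : TopTree T α c)

/-- The portals of a node: its root and its boundary vertices. -/
def Port (X : Fin τ.N) (b : Fin n) : Prop := b = τ.root X ∨ τ.IsBoundary X b

/-- The vertices that are relevant for combining the children of a node. -/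
def Hub (X : Fin τ.N) (v : Fin n) : Prop :=
  (∃ Y, τ.parent Y = some X ∧ τ.Port Y v) ∨ (τ.rank X = 0 ∧ v ∈ edgeVerts (τ.cluster X))

open Classical in
/-- The edges of the cluster of `X` whose lowest portal ancestor is `b`. -/
noncomputable def hang (X : Fin τ.N) (b : Fin n) : Finset (Sym2 (Fin n)) :=
  (τ.cluster X).filter fun e => T.IsAncestor b (T.top e) ∧
    ∀ b', τ.Port X b' → T.IsAncestor b b' → T.IsAncestor b' (T.top e) → b' = b

/-- The cluster of `X` is cut into the pieces `hang Y q`. -/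
def Piece (X Y : Fin τ.N) (q : Fin n) : Prop :=
  (τ.parent Y = some X ∧ τ.Port Y q) ∨ (τ.rank X = 0 ∧ Y = X ∧ q = τ.root X)

/-- `a` is the next portal of `Y` above the portal `b`. -/
def Cov (Y : Fin τ.N) (a b : Fin n) : Prop :=
  τ.Port Y a ∧ τ.Port Y b ∧ T.IsAncestor a b ∧ a ≠ b ∧
    ∀ c, τ.Port Y c → T.IsAncestor a c → T.IsAncestor c b → c = a ∨ c = b

variable {τ}

theorem rank_pos_of_parent {X Y : Fin τ.N} (h : τ.parent Y = some X) : 0 < τ.rank X := by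
  rw [τ.rank_parent X Y h]; omega

theorem cluster_subset_parent {X Y : Fin τ.N} (h : τ.parent Y = some X) :
    τ.cluster Y ⊆ τ.cluster X :=
  fun e he => (τ.cluster_eq X (rank_pos_of_parent h) e).2 ⟨Y, h, he⟩

theorem cluster_subset (X : Fin τ.N) : τ.cluster X ⊆ T.edges := by
  induction hr : τ.rank X using Nat.strong_induction_on generalizing X with
  | _ r ih =>
    intro e he
    by_cases h : τ.rank X = 0
    · obtain ⟨e', he', hX⟩ := τ.leaf_cluster X h
      rw [hX, Finset.mem_singleton] at he
      exact he ▸ he'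
    · obtain ⟨Y, hY, heY⟩ := (τ.cluster_eq X (by omega) e).1 he
      have := τ.rank_parent X Y hY
      exact ih (τ.rank Y) (by omega) Y rfl heY

/-- An edge has a unique leaf, and parents are unique, so the node of a given rank above that leaf
is determined. Clusters of equal rank are therefore disjoint. -/
theorem eq_of_mem_cluster {X Y : Fin τ.N} {e : Sym2 (Fin n)} (hr : τ.rank X = τ.rank Y)
    (hX : e ∈ τ.cluster X) (hY : e ∈ τ.cluster Y) : X = Y := by
  induction h : τ.rank X generalizing X Y with
  | zero =>
    have key : ∀ Z : Fin τ.N, τ.rank Z = 0 → e ∈ τ.cluster Z → τ.cluster Z = {e} := by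
      intro Z hZ heZ
      obtain ⟨e', -, hZ'⟩ := τ.leaf_cluster Z hZ
      rw [hZ', Finset.mem_singleton] at heZ
      rw [hZ', heZ]
    exact (τ.leaf_unique e (cluster_subset X hX)).unique ⟨h, key X h hX⟩
      ⟨hr ▸ h, key Y (hr ▸ h) hY⟩
  | succ r ih =>
    obtain ⟨X', hX', heX⟩ := (τ.cluster_eq X (by omega) e).1 hX
    obtain ⟨Y', hY', heY⟩ := (τ.cluster_eq Y (by omega) e).1 hY
    have h1 := τ.rank_parent X X' hX'
    have h2 := τ.rank_parent Y Y' hY'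
    have := ih (by omega) heX heY (by omega)
    rw [this, hY'] at hX'
    exact (Option.some.inj hX').symm

theorem sibling_eq {X Y Y' : Fin τ.N} {e : Sym2 (Fin n)} (h : τ.parent Y = some X)
    (h' : τ.parent Y' = some X) (he : e ∈ τ.cluster Y) (he' : e ∈ τ.cluster Y') : Y = Y' :=
  eq_of_mem_cluster (by have := τ.rank_parent X Y h; have := τ.rank_parent X Y' h'; omega) he he'

/-- Clusters grow along parent pointers, and ranks are bounded, so every chain of parents ends in
the only parentless node; in particular each leaf edge ends up there. -/
theorem cluster_eq_edges {X : Fin τ.N} (h : τ.parent X = none) : τ.cluster X = T.edges := by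
  have key : ∀ k, ∀ Z : Fin τ.N, Finset.univ.sup τ.rank - τ.rank Z = k →
      τ.cluster Z ⊆ τ.cluster X := by
    intro k
    induction k using Nat.strong_induction_on with
    | _ k ih =>
      intro Z hZ
      rcases hP : τ.parent Z with _ | P
      · rw [τ.top_unique Z X hP h]
      · have h1 := τ.rank_parent P Z hP
        have h2 : τ.rank P ≤ Finset.univ.sup τ.rank := Finset.le_sup (Finset.mem_univ P)
        exact (cluster_subset_parent hP).trans (ih _ (by omega) P rfl)
  refine (cluster_subset X).antisymm fun e he => ?_
  obtain ⟨Z, hZ, -⟩ := τ.leaf_unique e he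
  exact key _ Z rfl (by rw [hZ.2]; simp)

theorem cluster_nonempty (X : Fin τ.N) : (τ.cluster X).Nonempty := by
  obtain ⟨e, he, -⟩ := τ.root_mem X
  exact ⟨e, he⟩

theorem card_cluster {X : Fin τ.N} (h : 0 < τ.rank X) :
    (τ.cluster X).card = ∑ Y with τ.parent Y = some X, (τ.cluster Y).card := by
  rw [← Finset.card_biUnion]
  · congr 1
    ext e
    simp [τ.cluster_eq X h e]
  · intro Y hY Z hZ hYZ
    simp only [Finset.coe_filter, Finset.mem_univ, true_and, Set.mem_ofPred_eq] at hY hZ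
    rw [Function.onFun, Finset.disjoint_left]
    exact fun e h1 h2 => hYZ (sibling_eq hY hZ h1 h2)

theorem cluster_ne_edges {X P : Fin τ.N} (h : τ.parent X = some P) : τ.cluster X ≠ T.edges := by
  obtain ⟨Y, hY, Z, hZ, hYZ⟩ := Finset.one_lt_card.1 (τ.two_le_children P (rank_pos_of_parent h))
  simp only [Finset.mem_filter, Finset.mem_univ, true_and] at hY hZ
  intro hX
  have key : ∀ W, τ.parent W = some P → W = X := by
    intro W hW
    obtain ⟨e, he⟩ := cluster_nonempty W
    exact sibling_eq hW h he (hX ▸ cluster_subset W he)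
  exact hYZ ((key Y hY).trans (key Z hZ).symm)

/-- A node with a parent does not represent all of `T`, so it and all its inner descendants obey the
lower bound on the number of children; child clusters are disjoint, so sizes multiply. -/
theorem pow_rank_le_card {X P : Fin τ.N} (h : τ.parent X = some P) :
    ((n : ℝ) ^ (α / 2)) ^ τ.rank X ≤ ((τ.cluster X).card : ℝ) := by
  induction hr : τ.rank X generalizing X P with
  | zero => simpa using Finset.card_pos.2 (cluster_nonempty X)
  | succ r ih =>
    have hX : 0 < τ.rank X := by omega
    have hs : ∑ Y with τ.parent Y = some X, ((n : ℝ) ^ (α / 2)) ^ r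
        ≤ ∑ Y with τ.parent Y = some X, ((τ.cluster Y).card : ℝ) := by
      refine Finset.sum_le_sum fun Y hY => ?_
      simp only [Finset.mem_filter, Finset.mem_univ, true_and] at hY
      have := τ.rank_parent X Y hY
      exact ih hY (by omega)
    rw [card_cluster hX, pow_succ', Nat.cast_sum]
    refine le_trans ?_ hs
    rw [Finset.sum_const, nsmul_eq_mul]
    exact mul_le_mul_of_nonneg_right (τ.le_children X hX (cluster_ne_edges h)) (by positivity)

/-- The ranks of a balanced top tree are bounded. -/
theorem rank_le (hα : 0 < α) (X : Fin τ.N) : τ.rank X ≤ ⌊2 / α⌋₊ + 1 := by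
  have hn : 1 < n := by
    obtain ⟨e, he⟩ := cluster_nonempty X
    have h1 := (par_ends (cluster_subset X he)).1.ne
    have h2 := (T.top e).isLt
    have h3 := (T.bot e).isLt
    have h4 : (T.top e : ℕ) ≠ T.bot e := fun h => h1 (Fin.ext h)
    omega
  -- The size bound covers only nodes with a parent; the parentless node lies one rank above its
  -- children, which is the `+ 1`.
  have key : ∀ Y P : Fin τ.N, τ.parent Y = some P → τ.rank Y ≤ ⌊2 / α⌋₊ := by
    intro Y P hY
    refine Nat.le_floor ?_
    have h1 := pow_rank_le_card hY
    have h2 : ((τ.cluster Y).card : ℝ) ≤ (n : ℝ) ^ (1 : ℝ) := by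
      rw [Real.rpow_one]
      exact_mod_cast (Finset.card_le_card (cluster_subset Y)).trans card_edges_le
    have hn' : (1 : ℝ) < n := by exact_mod_cast hn
    have h3 := h1.trans h2
    rw [← Real.rpow_natCast, ← Real.rpow_mul (by positivity),
      Real.rpow_le_rpow_left_iff hn'] at h3
    rw [le_div_iff₀ hα]
    linarith
  by_cases h : τ.rank X = 0
  · omega
  · obtain ⟨Y, hY⟩ := Finset.card_pos.1 (lt_of_lt_of_le Nat.zero_lt_two
      (τ.two_le_children X (by omega)))
    simp only [Finset.mem_filter, Finset.mem_univ, true_and] at hY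
    have := key Y X hY
    have := τ.rank_parent X Y hY
    omega

/-! ### Portals, hubs and the decomposition into pieces -/

theorem exists_child {X : Fin τ.N} (h : 0 < τ.rank X) {v : Fin n}
    (hv : v ∈ edgeVerts (τ.cluster X)) :
    ∃ Y, τ.parent Y = some X ∧ v ∈ edgeVerts (τ.cluster Y) := by
  obtain ⟨e, he, hve⟩ := hv
  obtain ⟨Y, hY, heY⟩ := (τ.cluster_eq X h e).1 he
  exact ⟨Y, hY, e, heY, hve⟩

theorem edgeVerts_parent {X Y : Fin τ.N} (h : τ.parent Y = some X) {v : Fin n}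
    (hv : v ∈ edgeVerts (τ.cluster Y)) : v ∈ edgeVerts (τ.cluster X) := by
  obtain ⟨e, he, hve⟩ := hv
  exact ⟨e, cluster_subset_parent h he, hve⟩

theorem Port.mem {X : Fin τ.N} {b : Fin n} (h : τ.Port X b) : b ∈ edgeVerts (τ.cluster X) := by
  rcases h with rfl | h
  · exact τ.root_mem X
  · exact h.1

theorem Hub.mem {X : Fin τ.N} {b : Fin n} (h : τ.Hub X b) : b ∈ edgeVerts (τ.cluster X) := by
  rcases h with ⟨Y, hY, h⟩ | h
  · exact edgeVerts_parent hY h.mem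
  · exact h.2

theorem isVertex_of_mem {X : Fin τ.N} {b : Fin n} (h : b ∈ edgeVerts (τ.cluster X)) :
    T.IsVertex b := by
  obtain ⟨e, he, hb⟩ := h
  exact RootedTreeOn.isVertex_of_mem (cluster_subset X he) hb

theorem top_mem_edgeVerts {X : Fin τ.N} {e : Sym2 (Fin n)} (he : e ∈ τ.cluster X) :
    T.top e ∈ edgeVerts (τ.cluster X) :=
  ⟨e, he, top_mem (cluster_subset X he)⟩

/-- A vertex of two sibling clusters is a portal. -/
theorem Hub.port_child {X Y : Fin τ.N} {v : Fin n} (h : τ.Hub X v) (hY : τ.parent Y = some X)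
    (hv : v ∈ edgeVerts (τ.cluster Y)) : τ.Port Y v := by
  rcases h with ⟨Y', hY', hp⟩ | h
  · by_cases hYY : Y' = Y
    · exact hYY ▸ hp
    · obtain ⟨e, he, hve⟩ := hp.mem
      exact Or.inr ⟨hv, e, cluster_subset Y' he, fun h => hYY (sibling_eq hY' hY he h), hve⟩
  · have := rank_pos_of_parent hY
    omega

/-- An edge outside `X` is also outside the child that contains the portal, and if that child
contains the root of `X`, this vertex is its root too. Thus the order of the hubs includes the order
of the portals of `X` itself. -/
theorem Port.hub {X : Fin τ.N} {b : Fin n} (h : τ.Port X b) : τ.Hub X b := by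
  by_cases hr : τ.rank X = 0
  · exact Or.inr ⟨hr, h.mem⟩
  obtain ⟨Y, hY, hb⟩ := exists_child (by omega) h.mem
  refine Or.inl ⟨Y, hY, ?_⟩
  rcases h with rfl | ⟨-, e, he, heX, hbe⟩
  · exact Or.inl ((τ.root_ancestor X _ (edgeVerts_parent hY (τ.root_mem Y))).antisymm
      (τ.root_ancestor Y _ hb))
  · exact Or.inr ⟨hb, e, he, fun h => heX (cluster_subset_parent hY h), hbe⟩

theorem Piece.hub {X Y : Fin τ.N} {q : Fin n} (h : τ.Piece X Y q) : τ.Hub X q := by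
  rcases h with ⟨hY, h⟩ | ⟨hr, rfl, rfl⟩
  · exact Or.inl ⟨Y, hY, h⟩
  · exact Port.hub (Or.inl rfl)

theorem Piece.port {X Y : Fin τ.N} {q : Fin n} (h : τ.Piece X Y q) : τ.Port Y q := by
  rcases h with ⟨_, h⟩ | ⟨_, rfl, rfl⟩
  · exact h
  · exact Or.inl rfl

theorem Piece.cluster_subset {X Y : Fin τ.N} {q : Fin n} (h : τ.Piece X Y q) :
    τ.cluster Y ⊆ τ.cluster X := by
  rcases h with ⟨hY, h⟩ | ⟨hr, rfl, rfl⟩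
  · exact cluster_subset_parent hY
  · exact subset_rfl

theorem mem_hang {X : Fin τ.N} {b : Fin n} {e : Sym2 (Fin n)} :
    e ∈ τ.hang X b ↔ e ∈ τ.cluster X ∧ T.IsAncestor b (T.top e) ∧
    ∀ b', τ.Port X b' → T.IsAncestor b b' → T.IsAncestor b' (T.top e) → b' = b := by
  simp [hang]

theorem hang_subset (X : Fin τ.N) (b : Fin n) : τ.hang X b ⊆ T.edges :=
  fun _ he => cluster_subset X (mem_hang.1 he).1

theorem exists_hang {X : Fin τ.N} {e : Sym2 (Fin n)} (he : e ∈ τ.cluster X) :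
    ∃ b, τ.Port X b ∧ e ∈ τ.hang X b := by
  obtain ⟨b, hb, -, hbe, h⟩ := exists_lowest (P := τ.Port X) (Or.inl rfl)
    (τ.root_ancestor X _ (top_mem_edgeVerts he))
  exact ⟨b, hb, mem_hang.2 ⟨he, hbe, h⟩⟩

theorem hang_unique {X : Fin τ.N} {e : Sym2 (Fin n)} {b b' : Fin n} (hb : τ.Port X b)
    (hb' : τ.Port X b') (h : e ∈ τ.hang X b) (h' : e ∈ τ.hang X b') : b = b' := by
  rw [mem_hang] at h h'
  rcases h.2.1.total h'.2.1 with hbb | hbb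
  · exact (h.2.2 b' hb' hbb h'.2.1).symm
  · exact h'.2.2 b hb hbb h.2.1

theorem exists_piece {X : Fin τ.N} {e : Sym2 (Fin n)} (he : e ∈ τ.cluster X) :
    ∃ Y q, τ.Piece X Y q ∧ e ∈ τ.hang Y q := by
  by_cases hr : τ.rank X = 0
  · refine ⟨X, τ.root X, Or.inr ⟨hr, rfl, rfl⟩, mem_hang.2 ⟨he,
      τ.root_ancestor X _ (top_mem_edgeVerts he), fun b hb _ hbe => ?_⟩⟩
    obtain ⟨e', he', hX⟩ := τ.leaf_cluster X hr
    have hee : e = e' := by rwa [hX, Finset.mem_singleton] at he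
    subst hee
    have h1 : ∀ v ∈ edgeVerts (τ.cluster X), v = T.top e ∨ v = T.bot e := by
      rintro v ⟨e', he1, hv⟩
      rw [hX, Finset.mem_singleton] at he1
      exact (mem_edge_iff he').1 (he1 ▸ hv)
    have h2 := par_ends he'
    rcases h1 _ hb.mem with rfl | rfl
    · rcases h1 _ (τ.root_mem X) with h | h
      · exact h.symm
      · exact absurd (h ▸ τ.root_ancestor X _ hb.mem) h2.not_isAncestor
    · exact absurd hbe h2.not_isAncestor
  · obtain ⟨Y, hY, heY⟩ := (τ.cluster_eq X (by omega) e).1 he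
    obtain ⟨b, hb, h⟩ := exists_hang heY
    exact ⟨Y, b, Or.inl ⟨hY, hb⟩, h⟩

theorem piece_unique {X Y Y' : Fin τ.N} {e : Sym2 (Fin n)} {b b' : Fin n} (hb : τ.Piece X Y b)
    (hb' : τ.Piece X Y' b') (h : e ∈ τ.hang Y b) (h' : e ∈ τ.hang Y' b') : Y = Y' ∧ b = b' := by
  have hY : Y = Y' := by
    rcases hb with ⟨hY, _⟩ | ⟨hr, rfl, _⟩ <;> rcases hb' with ⟨hY', _⟩ | ⟨hr', rfl, _⟩
    · exact sibling_eq hY hY' (mem_hang.1 h).1 (mem_hang.1 h').1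
    · have := rank_pos_of_parent hY; omega
    · have := rank_pos_of_parent hY'; omega
    · rfl
  subst hY
  exact ⟨rfl, hang_unique hb.port hb'.port h h'⟩

/-- If a hub `p` above the edge lies in `Y`, it is a portal of `Y` in the inner case, and `q` is the
lowest portal of `Y` above the edge. If `p` lies outside `Y`, it must be above the root of `Y`,
since a connected cluster contains everything between its root and its vertices. A leaf has one edge
only and is checked directly. -/
theorem Hub.isAncestor_top_iff {X Y : Fin τ.N} {p q : Fin n} {e : Sym2 (Fin n)}
    (hp : τ.Hub X p) (hq : τ.Piece X Y q) (he : e ∈ τ.hang Y q) :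
    T.IsAncestor p (T.top e) ↔ T.IsAncestor p q := by
  rw [mem_hang] at he
  refine ⟨fun h => ?_, fun h => h.trans he.2.1⟩
  have hpq : τ.Port Y p → T.IsAncestor p q := by
    intro hpY
    rcases h.total he.2.1 with hpq | hqp
    · exact hpq
    · rw [he.2.2 p hpY hqp h]
      exact isAncestor_refl (isVertex_of_mem hq.port.mem)
  have ht := top_mem_edgeVerts he.1
  by_cases hpY : p ∈ edgeVerts (τ.cluster Y)
  · rcases id hq with ⟨hY, -⟩ | ⟨hr, rfl, rfl⟩
    · exact hpq (hp.port_child hY hpY)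
    · obtain ⟨e', he', hX⟩ := τ.leaf_cluster Y hr
      have hee := he.1
      rw [hX, Finset.mem_singleton] at hee
      subst hee
      obtain ⟨e1, he1, hpe⟩ := hpY
      rw [hX, Finset.mem_singleton] at he1
      rcases (mem_edge_iff he').1 (he1 ▸ hpe) with rfl | rfl
      · obtain ⟨e2, he2, hre⟩ := τ.root_mem Y
        rw [hX, Finset.mem_singleton] at he2
        rcases (mem_edge_iff he').1 (he2 ▸ hre) with hr1 | hr1
        · rwa [← hr1] at h ⊢
        · exact absurd (hr1 ▸ he.2.1) (par_ends he').not_isAncestor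
      · exact absurd h (par_ends he').not_isAncestor
  · rcases h.total (τ.root_ancestor Y _ ht) with hpr | hrp
    · exact hpr.trans (τ.root_ancestor Y _ hq.port.mem)
    · exact absurd (mem_edgeVerts_of_between (TopTree.cluster_subset Y) (τ.cluster_connected Y)
        (τ.root_mem Y) (τ.root_ancestor Y) ht hrp h) hpY

/-- The edges hanging off a portal of a node are composed of pieces. -/
theorem mem_hang_iff {X : Fin τ.N} {b : Fin n} (hb : τ.Hub X b) {e : Sym2 (Fin n)} :
    e ∈ τ.hang X b ↔ ∃ Y q, (τ.Piece X Y q ∧ T.IsAncestor b q ∧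
      ∀ b', τ.Port X b' → T.IsAncestor b b' → T.IsAncestor b' q → b' = b) ∧ e ∈ τ.hang Y q := by
  constructor
  · intro he
    have he' := mem_hang.1 he
    obtain ⟨Y, q, hq, heq⟩ := exists_piece he'.1
    refine ⟨Y, q, ⟨hq, (hb.isAncestor_top_iff hq heq).1 he'.2.1, fun b' hb' h1 h2 => ?_⟩, heq⟩
    exact he'.2.2 b' hb' h1 ((hb'.hub.isAncestor_top_iff hq heq).2 h2)
  · rintro ⟨Y, q, ⟨hq, hbq, h⟩, heq⟩
    refine mem_hang.2 ⟨hq.cluster_subset (mem_hang.1 heq).1,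
      (hb.isAncestor_top_iff hq heq).2 hbq, fun b' hb' h1 h2 => ?_⟩
    exact h b' hb' h1 ((hb'.hub.isAncestor_top_iff hq heq).1 h2)

/-- The edges below a hub of a node are composed of pieces and of the edges below those portals
for which these edges are known. -/
theorem mem_subtreeEdges_iff {X : Fin τ.N} {q : Fin n} (hq : τ.Hub X q) {K : Fin n → Prop}
    (hK : ∀ b, K b → τ.Port X b) (hX : τ.cluster X = T.edges ∨ ∀ b, τ.Port X b → K b)
    {e : Sym2 (Fin n)} :
    e ∈ T.subtreeEdges q ↔
      (∃ Y p, (τ.Piece X Y p ∧ T.IsAncestor q p ∧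
        ∀ b, K b → T.IsAncestor q b → ¬ T.IsAncestor b p) ∧ e ∈ τ.hang Y p) ∨
      ∃ b, (K b ∧ T.IsAncestor q b ∧ ∀ b', K b' → T.IsAncestor q b' → T.IsAncestor b' b → b' = b) ∧
        e ∈ T.subtreeEdges b := by
  constructor
  · intro he
    rw [mem_subtreeEdges] at he
    by_cases h : ∃ b, (K b ∧ T.IsAncestor q b) ∧ T.IsAncestor b (T.top e)
    · right
      obtain ⟨b, hb, hbe⟩ := h
      obtain ⟨b', hb', hbb, hmin⟩ := exists_highest
        (P := fun b => K b ∧ T.IsAncestor q b) hb hbe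
      exact ⟨b', ⟨hb'.1, hb'.2, fun c hc hqc hcb => hmin c ⟨hc, hqc⟩ hcb⟩,
        mem_subtreeEdges.2 ⟨he.1, hbb.trans hbe⟩⟩
    · left
      push Not at h
      -- An edge below `q` outside the cluster would hang off a boundary vertex below `q`, which is
      -- a portal in `K`; this case has been excluded.
      have heX : e ∈ τ.cluster X := by
        rcases hX with hX | hX
        · rw [hX]; exact he.1
        · by_contra heX
          obtain ⟨b, hb, hbe, hqb, hbt⟩ := exists_boundary hq.mem he.1 heX he.2
          exact h b ⟨hX b (Or.inr ⟨hb, hbe⟩), hqb⟩ hbt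
      obtain ⟨Y, p, hp, hep⟩ := exists_piece heX
      refine ⟨Y, p, ⟨hp, (hq.isAncestor_top_iff hp hep).1 he.2, fun b hb hqb hbp => ?_⟩, hep⟩
      exact h b ⟨hb, hqb⟩ (((hK b hb).hub.isAncestor_top_iff hp hep).2 hbp)
  · rintro (⟨Y, p, ⟨hp, hqp, -⟩, hep⟩ | ⟨b, ⟨hb, hqb, -⟩, heb⟩)
    · exact mem_subtreeEdges.2 ⟨hang_subset Y p hep, (hq.isAncestor_top_iff hp hep).2 hqp⟩
    · rw [mem_subtreeEdges] at heb ⊢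
      exact ⟨heb.1, hqb.trans heb.2⟩

/-- The order of the portals is generated by its covering relation. -/
theorem Port.reflTransGen_cov {X : Fin τ.N} {a b : Fin n} (ha : τ.Port X a) (hb : τ.Port X b)
    (hab : T.IsAncestor a b) : Relation.ReflTransGen (τ.Cov X) a b := by
  induction hd : T.graph.dist T.root b using Nat.strong_induction_on generalizing b with
  | _ d ih =>
    by_cases h : a = b
    · rw [h]
    · obtain ⟨p, ⟨hp, hpb⟩, hap, hpb', hlow⟩ := exists_lowest
        (P := fun p => τ.Port X p ∧ p ≠ b) ⟨ha, h⟩ hab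
      have hd' := hpb'.dist_le.resolve_left hpb
      refine (ih _ (by omega) hp hap rfl).tail ⟨hp, hb, hpb', hpb, fun c hc hpc hcb => ?_⟩
      by_cases hcb' : c = b
      · exact Or.inr hcb'
      · exact Or.inl (hlow c ⟨hc, hcb'⟩ hpc hcb)

/-- The order of the hubs of an inner node is generated by the covering relations of its
children. -/
theorem Hub.reflTransGen_cov {X : Fin τ.N} (hr : 0 < τ.rank X) {a b : Fin n} (ha : τ.Hub X a)
    (hb : τ.Hub X b) (hab : T.IsAncestor a b) :
    Relation.ReflTransGen (fun a b => ∃ Y, τ.parent Y = some X ∧ τ.Cov Y a b) a b := by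
  induction hd : T.graph.dist T.root b using Nat.strong_induction_on generalizing b with
  | _ d ih =>
    by_cases h : a = b
    · rw [h]
    have hbr : b ≠ τ.root X := by
      rintro rfl
      exact h (hab.antisymm (τ.root_ancestor X _ ha.mem))
    -- The parent edge of `b` lies in some child `Y`. Either `a` is in `Y` and the portal order of
    -- `Y` suffices, or `a` is above the root of `Y` and the induction continues from that root.
    obtain ⟨e, he, rfl⟩ := exists_bot_eq (cluster_subset X) (τ.cluster_connected X)
      (τ.root_mem X) (τ.root_ancestor X) hb.mem hbr
    obtain ⟨Y, hY, heY⟩ := (τ.cluster_eq X hr e).1 he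
    have hlift : ∀ {a b}, Relation.ReflTransGen (τ.Cov Y) a b →
        Relation.ReflTransGen (fun a b => ∃ Y, τ.parent Y = some X ∧ τ.Cov Y a b) a b :=
      fun h => Relation.ReflTransGen.mono (fun _ _ h => ⟨Y, hY, h⟩) _ _ h
    have heT := cluster_subset X he
    have hbY : T.bot e ∈ edgeVerts (τ.cluster Y) := ⟨e, heY, bot_mem heT⟩
    have hpb := hb.port_child hY hbY
    by_cases haY : a ∈ edgeVerts (τ.cluster Y)
    · exact hlift ((ha.port_child hY haY).reflTransGen_cov hpb hab)
    · have hrb := τ.root_ancestor Y _ hbY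
      have har : T.IsAncestor a (τ.root Y) := by
        rcases hab.total hrb with h | h
        · exact h
        · exact absurd (mem_edgeVerts_of_between (cluster_subset Y) (τ.cluster_connected Y)
            (τ.root_mem Y) (τ.root_ancestor Y) hbY h hab) haY
      have hne : τ.root Y ≠ T.bot e := by
        intro h
        have h1 := τ.root_ancestor Y _ (top_mem_edgeVerts heY)
        exact (par_ends heT).not_isAncestor (h ▸ h1)
      have hd' := hrb.dist_le.resolve_left hne
      have hport : τ.Port Y (τ.root Y) := Or.inl rfl
      exact (ih _ (by omega) (Or.inl ⟨Y, hY, hport⟩) har rfl).trans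
        (hlift (hport.reflTransGen_cov hpb hrb))

end TopTree

/-! ### Lists of records as memory contents, and counting of records -/

section Records

theorem flatRecords_cons (r : List ℕ) (L : List (List ℕ)) :
    flatRecords (r :: L) = r.length :: (r ++ flatRecords L) := by
  simp [flatRecords]

/-- The length word in front of each record makes the sequence uniquely parsable, so a memory
determines its set of records whatever their order. -/
theorem flatRecords_injective {L L' : List (List ℕ)} (h : flatRecords L = flatRecords L') :
    L = L' := by
  induction L generalizing L' with
  | nil =>
    cases L' with
    | nil => rfl
    | cons r L' => simp [flatRecords_cons] at h; simp [flatRecords] at h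
  | cons r L ih =>
    cases L' with
    | nil => simp [flatRecords_cons] at h; simp [flatRecords] at h
    | cons r' L' =>
      rw [flatRecords_cons, flatRecords_cons, List.cons.injEq] at h
      obtain ⟨h1, h2⟩ := List.append_inj h.2 h.1
      rw [h1, ih h2]

theorem length_flatRecords_le {L : List (List ℕ)} {K : ℕ} (h : ∀ r ∈ L, r.length + 1 ≤ K) :
    (flatRecords L).length ≤ K * L.length := by
  induction L with
  | nil => simp [flatRecords]
  | cons r L ih =>
    have h1 := h r (by simp)
    have h2 := ih fun r hr => h r (by simp [hr])
    rw [flatRecords_cons, List.length_cons, List.length_append, List.length_cons, mul_add]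
    omega

theorem length_le_length_flatRecords (L : List (List ℕ)) : L.length ≤ (flatRecords L).length := by
  induction L with
  | nil => simp
  | cons r L ih =>
    rw [flatRecords_cons, List.length_cons, List.length_cons, List.length_append]
    omega

theorem mem_flatRecords {L : List (List ℕ)} {w : ℕ} :
    w ∈ flatRecords L ↔ ∃ r ∈ L, w = r.length ∨ w ∈ r := by
  simp [flatRecords]

/-- The memory `x` is a listing of the set `S` of records. -/
def ListsRecords (x : List ℕ) (S : Set (List ℕ)) : Prop :=
  ∃ L : List (List ℕ), L.Nodup ∧ (∀ r, r ∈ L ↔ r ∈ S) ∧ x = flatRecords L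

/-- The set of records that are written in a memory. -/
def content (x : List ℕ) : Set (List ℕ) := {r | ∃ L, x = flatRecords L ∧ r ∈ L}

open Classical in
/-- A listing of a finite set of records. -/
noncomputable def write (S : Set (List ℕ)) : List ℕ :=
  -- The default value plays no role: all sets written in a run from a stored top tree are finite.
  if h : S.Finite then flatRecords h.toFinset.toList else []

theorem ListsRecords.content_eq {x : List ℕ} {S : Set (List ℕ)} (h : ListsRecords x S) : content x = S := by
  obtain ⟨L, -, hL, rfl⟩ := h
  ext r
  rw [← hL]
  constructor
  · rintro ⟨L', h, hr⟩
    rwa [flatRecords_injective h]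
  · exact fun hr => ⟨L, rfl, hr⟩

theorem listsRecords_write {S : Set (List ℕ)} (h : S.Finite) : ListsRecords (write S) S :=
  ⟨h.toFinset.toList, Finset.nodup_toList _, by simp, by simp [write, h]⟩

theorem ncard_eq_length {S : Set (List ℕ)} {L : List (List ℕ)} (hL : L.Nodup)
    (h : ∀ r, r ∈ L ↔ r ∈ S) : S.Finite ∧ S.ncard = L.length := by
  have : S = (L.toFinset : Set (List ℕ)) := by ext r; simp [h]
  rw [this]
  exact ⟨Finset.finite_toSet _, by rw [Set.ncard_coe_finset, List.toFinset_card_of_nodup hL]⟩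

theorem ListsRecords.finite {x : List ℕ} {S : Set (List ℕ)} (h : ListsRecords x S) : S.Finite := by
  obtain ⟨L, hn, hL, rfl⟩ := h
  exact (ncard_eq_length hn hL).1

theorem ListsRecords.ncard_le {x : List ℕ} {S : Set (List ℕ)} (h : ListsRecords x S) : S.ncard ≤ x.length := by
  obtain ⟨L, hn, hL, rfl⟩ := h
  rw [(ncard_eq_length hn hL).2]
  exact length_le_length_flatRecords L

theorem ListsRecords.length_le {x : List ℕ} {S : Set (List ℕ)} (h : ListsRecords x S) {K : ℕ}
    (hK : ∀ r ∈ S, r.length + 1 ≤ K) : x.length ≤ K * S.ncard := by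
  obtain ⟨L, hn, hL, rfl⟩ := h
  rw [(ncard_eq_length hn hL).2]
  exact length_flatRecords_le fun r hr => hK r ((hL r).1 hr)

theorem ListsRecords.lt {x : List ℕ} {S : Set (List ℕ)} (h : ListsRecords x S) {W : ℕ}
    (hW : ∀ r ∈ S, r.length < W ∧ ∀ w ∈ r, w < W) : ∀ w ∈ x, w < W := by
  obtain ⟨L, hn, hL, rfl⟩ := h
  intro w hw
  obtain ⟨r, hr, rfl | hw⟩ := mem_flatRecords.1 hw
  · exact (hW r ((hL r).1 hr)).1
  · exact (hW r ((hL r).1 hr)).2 w hw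

theorem ListsRecords.mem_lt {x : List ℕ} {S : Set (List ℕ)} (h : ListsRecords x S) {W : ℕ}
    (hW : ∀ w ∈ x, w < W) {r : List ℕ} (hr : r ∈ S) {w : ℕ} (hw : w ∈ r) : w < W := by
  obtain ⟨L, hn, hL, rfl⟩ := h
  exact hW w (mem_flatRecords.2 ⟨r, (hL r).2 hr, Or.inr hw⟩)

/-- A set of records that are determined by a key below `m` and a record of `A`. -/
theorem ncard_le_of_determined {A B : Set (List ℕ)} (hA : A.Finite) {m : ℕ} (key : List ℕ → ℕ)
    (hkey : ∀ r ∈ B, key r < m) (R : List ℕ → List ℕ → Prop) (hR : ∀ r ∈ B, ∃ a ∈ A, R a r)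
    (hfun : ∀ a r r', R a r → R a r' → key r = key r' → r = r') :
    B.Finite ∧ B.ncard ≤ m * A.ncard := by
  choose! φ hφA hφR using hR
  have hmaps : Set.MapsTo (fun r => (key r, φ r)) B (Set.Iio m ×ˢ A) :=
    fun r hr => ⟨hkey r hr, hφA r hr⟩
  have hinj : Set.InjOn (fun r => (key r, φ r)) B := by
    intro r hr r' hr' h
    simp only [Prod.mk.injEq] at h
    exact hfun (φ r) r r' (hφR r hr) (h.2 ▸ hφR r' hr') h.1
  have hfin : (Set.Iio m ×ˢ A).Finite := (Set.finite_Iio m).prod hA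
  refine ⟨hfin.of_injOn hmaps hinj, (Set.ncard_le_ncard_of_injOn _ hmaps hinj hfin).trans ?_⟩
  rw [Set.ncard_prod]
  simp

theorem sum_ncard_le {M : ℕ} {B : Fin M → Set (List ℕ)} {U : Set (List ℕ)} (hU : U.Finite)
    (hB : ∀ j, B j ⊆ U) (hdisj : ∀ r j j', r ∈ B j → r ∈ B j' → j = j') :
    ∑ j, (B j).ncard ≤ U.ncard := by
  classical
  have h1 : ∀ j, (B j).ncard = (hU.toFinset.filter (· ∈ B j)).card := by
    intro j
    rw [← Set.ncard_coe_finset]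
    congr 1
    ext r
    simpa using fun h => hB j h
  simp_rw [h1]
  rw [← Finset.card_biUnion, Set.ncard_eq_toFinset_card U hU]
  · exact Finset.card_le_card (by intro r; simp; tauto)
  · intro j _ j' _ hjj
    rw [Function.onFun, Finset.disjoint_left]
    intro r h h'
    simp only [Finset.mem_filter] at h h'
    exact hjj (hdisj r j j' h.2 h'.2)

end Records

/-! ### Representing `f'` by words, with a neutral code for the empty set -/

section Coding

variable {n : ℕ} {Λ β γ : Type*}

open Classical in
/-- The words that represent the value of `f'` on a possibly empty edge set. -/
noncomputable def edgeCode (f' : Finset (Sym2 (Fin n) × Λ) → β) (encB : β → List ℕ)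
    (l : Sym2 (Fin n) → Λ) (E : Finset (Sym2 (Fin n))) : List ℕ :=
  if E = ∅ then [] else 1 :: encB (f' (labelled l E))

variable {f : Finset (Sym2 (Fin n) × Λ) → γ} {f' : Finset (Sym2 (Fin n) × Λ) → β}
  {g : β → β → β} {g' : β → γ} {encL : Λ → List ℕ} {encB : β → List ℕ} {k W : ℕ}

@[simp] theorem edgeCode_empty (l : Sym2 (Fin n) → Λ) : edgeCode f' encB l ∅ = [] := by
  simp [edgeCode]

theorem edgeCode_of_nonempty (l : Sym2 (Fin n) → Λ) {E : Finset (Sym2 (Fin n))}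
    (h : E.Nonempty) : edgeCode f' encB l E = 1 :: encB (f' (labelled l E)) := by
  simp [edgeCode, h.ne_empty]

/-- Faithful codes can be decoded, joined by `g` and encoded again. The empty set gets the neutral
code `[]`, since `g` says nothing about it; the leading `1` of other codes keeps them apart from
`[]` even for `k = 0`. -/
theorem exists_join (h : IsDistributiveAggregative f f' g g')
    (hB : IsWordCode encB {b | ∃ l E, IsEdgeSet E ∧ E.Nonempty ∧ b = f' (labelled l E)} k W) :
    ∃ join : List ℕ → List ℕ → List ℕ, ∀ (l : Sym2 (Fin n) → Λ) (E₁ E₂), IsEdgeSet E₁ →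
      IsEdgeSet E₂ → Disjoint E₁ E₂ →
      join (edgeCode f' encB l E₁) (edgeCode f' encB l E₂) = edgeCode f' encB l (E₁ ∪ E₂) := by
  classical
  have : Nonempty β := ⟨f' ∅⟩
  let dec := Function.invFunOn encB
    {b | ∃ l E, IsEdgeSet E ∧ E.Nonempty ∧ b = f' (labelled l E)}
  refine ⟨fun x y => if x = [] then y else if y = [] then x else
    1 :: encB (g (dec x.tail) (dec y.tail)), fun l E₁ E₂ h₁ h₂ hd => ?_⟩
  rcases E₁.eq_empty_or_nonempty with rfl | hn₁
  · simp
  rcases E₂.eq_empty_or_nonempty with rfl | hn₂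
  · simp
  have hdec : ∀ E, IsEdgeSet E → E.Nonempty → dec (encB (f' (labelled l E))) =
      f' (labelled l E) := fun E hE hn => hB.injOn.leftInvOn_invFunOn ⟨l, E, hE, hn, rfl⟩
  rw [edgeCode_of_nonempty l hn₁, edgeCode_of_nonempty l hn₂,
    edgeCode_of_nonempty l (hn₁.mono Finset.subset_union_left)]
  simp [hdec, h₁, h₂, hn₁, hn₂, h.union l E₁ E₂ h₁ h₂ hn₁ hn₂ hd]

/-- The label is recovered from its code, so the function depends on the words alone and not on the
labelling `l`; the algorithm can be fixed before the tree is given. -/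
theorem exists_single (f' : Finset (Sym2 (Fin n) × Λ) → β) (encB : β → List ℕ)
    (hL : IsWordCode encL Set.univ k W) :
    ∃ single : ℕ → ℕ → List ℕ → List ℕ, ∀ (l : Sym2 (Fin n) → Λ) (u v : Fin n),
      single u v (encL (l s(u, v))) = edgeCode f' encB l {s(u, v)} := by
  classical
  refine ⟨fun u v x => if h : ∃ p : Fin n × Fin n × Λ, (p.1 : ℕ) = u ∧ (p.2.1 : ℕ) = v ∧
    encL p.2.2 = x then 1 :: encB (f' {(s(h.choose.1, h.choose.2.1), h.choose.2.2)}) else [],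
    fun l u v => ?_⟩
  have h : ∃ p : Fin n × Fin n × Λ, (p.1 : ℕ) = u ∧ (p.2.1 : ℕ) = v ∧
    encL p.2.2 = encL (l s(u, v)) := ⟨(u, v, l s(u, v)), rfl, rfl, rfl⟩
  obtain ⟨h1, h2, h3⟩ := h.choose_spec
  rw [edgeCode_of_nonempty l (Finset.singleton_nonempty _)]
  simp only [dif_pos h]
  rw [Fin.ext h1, Fin.ext h2, hL.injOn (Set.mem_univ _) (Set.mem_univ _) h3]
  rfl

/-- The code `[]` is sent to the code of the arbitrary value `f ∅`; any other code is decoded and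
passed to `g'`. -/
theorem exists_finish {encC : γ → List ℕ} (h : IsDistributiveAggregative f f' g g')
    (hB : IsWordCode encB {b | ∃ l E, IsEdgeSet E ∧ E.Nonempty ∧ b = f' (labelled l E)} k W) :
    ∃ finish : List ℕ → List ℕ, ∀ (l : Sym2 (Fin n) → Λ) (E), IsEdgeSet E →
      finish (edgeCode f' encB l E) = encC (f (labelled l E)) := by
  classical
  have : Nonempty β := ⟨f' ∅⟩
  let dec := Function.invFunOn encB
    {b | ∃ l E, IsEdgeSet E ∧ E.Nonempty ∧ b = f' (labelled l E)}
  refine ⟨fun x => if x = [] then encC (f ∅) else encC (g' (dec x.tail)), fun l E hE => ?_⟩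
  rcases E.eq_empty_or_nonempty with rfl | hn
  · simp [labelled]
  have hdec : dec (encB (f' (labelled l E))) = f' (labelled l E) :=
    hB.injOn.leftInvOn_invFunOn ⟨l, E, hE, hn, rfl⟩
  rw [edgeCode_of_nonempty l hn, h.value l E hE hn]
  simp [hdec]

theorem length_edgeCode_le
    (hB : IsWordCode encB {b | ∃ l E, IsEdgeSet E ∧ E.Nonempty ∧ b = f' (labelled l E)} k W)
    (l : Sym2 (Fin n) → Λ) {E : Finset (Sym2 (Fin n))} (hE : IsEdgeSet E) :
    (edgeCode f' encB l E).length ≤ k + 1 := by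
  rcases E.eq_empty_or_nonempty with rfl | hn
  · simp
  · rw [edgeCode_of_nonempty l hn, List.length_cons, hB.length _ ⟨l, E, hE, hn, rfl⟩]

theorem edgeCode_lt {W' : ℕ} (hW : 1 < W') (hWW : W ≤ W')
    (hB : IsWordCode encB {b | ∃ l E, IsEdgeSet E ∧ E.Nonempty ∧ b = f' (labelled l E)} k W)
    (l : Sym2 (Fin n) → Λ) {E : Finset (Sym2 (Fin n))} (hE : IsEdgeSet E) :
    ∀ w ∈ edgeCode f' encB l E, w < W' := by
  rcases E.eq_empty_or_nonempty with rfl | hn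
  · simp
  · rw [edgeCode_of_nonempty l hn]
    intro w hw
    rcases List.mem_cons.1 hw with rfl | hw
    · exact hW
    · exact (hB.lt _ ⟨l, E, hE, hn, rfl⟩ w hw).trans_le hWW

open Classical in
/-- The join of the second components of a finite set of pairs. -/
noncomputable def combine (join : List ℕ → List ℕ → List ℕ) (s : Set (List ℕ × List ℕ)) :
    List ℕ :=
  if h : s.Finite then (h.toFinset.toList.map Prod.snd).foldr join [] else []

/-- `join` computes the code of a disjoint union of edge sets of `T`. -/
structure JoinsCodes (T : RootedTreeOn n) (join : List ℕ → List ℕ → List ℕ)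
    (code : Finset (Sym2 (Fin n)) → List ℕ) : Prop where
  empty : code ∅ = []
  union : ∀ E₁ E₂, E₁ ⊆ T.edges → E₂ ⊆ T.edges → Disjoint E₁ E₂ →
    join (code E₁) (code E₂) = code (E₁ ∪ E₂)

/-- The injective tags keep sets with equal codes from collapsing in the set of pairs. No
commutativity of `join` is needed: in whichever order the list is folded, each partial result is the
code of a union of disjoint sets. -/
theorem JoinsCodes.combine_eq {T : RootedTreeOn n} {join : List ℕ → List ℕ → List ℕ}
    {code : Finset (Sym2 (Fin n)) → List ℕ} (h : JoinsCodes T join code) {κ : Type*} [Finite κ]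
    (J : Set κ) {tag : κ → List ℕ} (htag : Function.Injective tag)
    {A : κ → Finset (Sym2 (Fin n))}
    (hdisj : ∀ i ∈ J, ∀ j ∈ J, ∀ e, e ∈ A i → e ∈ A j → i = j)
    {U : Finset (Sym2 (Fin n))} (hU : ∀ e, e ∈ U ↔ ∃ j ∈ J, e ∈ A j) (hUT : U ⊆ T.edges) :
    combine join {p | ∃ j ∈ J, p = (tag j, code (A j))} = code U := by
  classical
  have key : ∀ (L : List κ), L.Nodup → (∀ j ∈ L, j ∈ J) → ∀ U : Finset (Sym2 (Fin n)),
      (∀ e, e ∈ U ↔ ∃ j ∈ L, e ∈ A j) → U ⊆ T.edges →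
      (L.map fun j => code (A j)).foldr join [] = code U := by
    intro L
    induction L with
    | nil =>
      intro _ _ U hU _
      have : U = ∅ := Finset.eq_empty_of_forall_notMem fun e he => by simpa using (hU e).1 he
      simp [this, h.empty]
    | cons j L ih =>
      intro hn hJ U hU hUT
      have hsub : L.toFinset.biUnion A ⊆ U := by
        intro e he
        obtain ⟨i, hi, hei⟩ := Finset.mem_biUnion.1 he
        exact (hU e).2 ⟨i, by simp [List.mem_toFinset.1 hi], hei⟩
      have hsub' : A j ⊆ U := fun e he => (hU e).2 ⟨j, by simp, he⟩
      rw [List.map_cons, List.foldr_cons, ih (List.nodup_cons.1 hn).2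
        (fun i hi => hJ i (by simp [hi])) (L.toFinset.biUnion A) (by simp) (hsub.trans hUT),
        h.union _ _ (hsub'.trans hUT) (hsub.trans hUT)]
      · congr 1
        ext e
        simp [hU e]
      · rw [Finset.disjoint_left]
        intro e he he'
        obtain ⟨i, hi, hei⟩ := Finset.mem_biUnion.1 he'
        rw [List.mem_toFinset] at hi
        have := hdisj j (hJ j (by simp)) i (hJ i (by simp [hi])) e he hei
        exact (List.nodup_cons.1 hn).1 (this ▸ hi)
  set φ : κ → List ℕ × List ℕ := fun j => (tag j, code (A j)) with hφ
  have hinj : Function.Injective φ := fun i j hij => htag (Prod.mk.inj hij).1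
  have hs : {p | ∃ j ∈ J, p = (tag j, code (A j))} = φ '' J := by
    ext p
    simp [hφ, eq_comm]
  rw [hs]
  have hfin : (φ '' J).Finite := (Set.toFinite J).image φ
  obtain ⟨L, hL⟩ : ∃ L : List κ, L.map φ = hfin.toFinset.toList := by
    have : ∀ p ∈ hfin.toFinset.toList, p ∈ Set.range φ := by
      intro p hp
      rw [Finset.mem_toList, Set.Finite.mem_toFinset] at hp
      exact Set.image_subset_range _ _ hp
    have h2 := Set.range_list_map φ
    have h3 : hfin.toFinset.toList ∈ Set.range (List.map φ) := by
      rw [h2]; exact this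
    exact h3
  have hmem : ∀ j, j ∈ L ↔ j ∈ J := by
    intro j
    rw [← hinj.mem_set_image, ← List.mem_map_of_injective hinj, hL, Finset.mem_toList,
      Set.Finite.mem_toFinset]
  rw [combine, dif_pos hfin, ← hL, List.map_map]
  refine key L ?_ (fun j => (hmem j).1) U (by simpa [hmem] using hU) hUT
  exact List.Nodup.of_map φ (hL ▸ Finset.nodup_toList _)

end Coding

/-! ### The algorithm in terms of records -/

section Algorithm

/-- In the records `S`, `b` is a portal of the node `X`. -/
def PortIn (S : Set (List ℕ)) (X b : ℕ) : Prop := [2, X, b] ∈ S ∨ [3, X, b] ∈ S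

/-- The ancestor relation among the hubs of the node `X` as generated by the records `S`. -/
def LeIn (S : Set (List ℕ)) (X : ℕ) : ℕ → ℕ → Prop :=
  Relation.ReflTransGen fun a b => (∃ Y, [10, X, Y, a, b] ∈ S) ∨
    ∃ x, (6 :: X :: a :: b :: x) ∈ S ∧ [2, X, a] ∈ S

/-- In the records `S`, `a` is the next portal of `X` above the portal `b`. -/
def CovIn (S : Set (List ℕ)) (X a b : ℕ) : Prop :=
  PortIn S X a ∧ PortIn S X b ∧ LeIn S X a b ∧ a ≠ b ∧
    ∀ c, PortIn S X c → LeIn S X a c → LeIn S X c b → c = a ∨ c = b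

/-- The records `S` contain the code `x` of the piece of `X` that hangs off `q` in `Y`. -/
def PieceIn (single : ℕ → ℕ → List ℕ → List ℕ) (S : Set (List ℕ)) (X Y q : ℕ) (x : List ℕ) :
    Prop :=
  (11 :: X :: Y :: q :: x) ∈ S ∨
    (Y = X ∧ ∃ v y, (6 :: X :: q :: v :: y) ∈ S ∧ [2, X, q] ∈ S ∧ x = single q v y)

variable (join : List ℕ → List ℕ → List ℕ) (single : ℕ → ℕ → List ℕ → List ℕ)
  (finish : List ℕ → List ℕ)

/-- The code of the edges of the cluster of `X` that hang off the portal `b`. -/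
noncomputable def hangCode (S : Set (List ℕ)) (X b : ℕ) : List ℕ :=
  combine join {p | ∃ Y q x, PieceIn single S X Y q x ∧ p = ([Y, q], x) ∧ LeIn S X b q ∧
    ∀ b', PortIn S X b' → LeIn S X b b' → LeIn S X b' q → b' = b}

/-- The code of all edges below the hub `q` of `X`. -/
noncomputable def belowCode (S : Set (List ℕ)) (X q : ℕ) : List ℕ :=
  combine join ({p | ∃ Y a x, PieceIn single S X Y a x ∧ p = ([Y, a], x) ∧ LeIn S X q a ∧
      ∀ b y, (12 :: X :: b :: y) ∈ S → LeIn S X q b → ¬ LeIn S X b a} ∪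
    {p | ∃ b x, (12 :: X :: b :: x) ∈ S ∧ p = ([b], x) ∧ LeIn S X q b ∧
      ∀ b' y, (12 :: X :: b' :: y) ∈ S → LeIn S X q b' → LeIn S X b' b → b' = b})

/-- The records that a machine with records `S` sends to machine `j` in round `t`: the nodes of
rank `t` report to their parents, and those of rank `2 * H + 1 - t` to their children. -/
def outgoing (H t : ℕ) (S : Set (List ℕ)) (j : ℕ) : Set (List ℕ) :=
  {r | (∃ X P, [0, X, t] ∈ S ∧ [1, X, j, P] ∈ S ∧
      ((∃ a b, CovIn S X a b ∧ r = [10, P, X, a, b]) ∨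
        ∃ b, PortIn S X b ∧ r = 11 :: P :: X :: b :: hangCode join single S X b)) ∨
    ∃ X h Y q x, [0, X, h] ∈ S ∧ t + h = 2 * H + 1 ∧ [4, X, j, Y] ∈ S ∧
      (11 :: X :: Y :: q :: x) ∈ S ∧ r = 12 :: Y :: q :: belowCode join single S X q}

/-- The final records of a machine with records `S`. -/
def results (S : Set (List ℕ)) : Set (List ℕ) :=
  {r | (∃ X u v x, (6 :: X :: u :: v :: x) ∈ S ∧ r = u :: finish (belowCode join single S X u)) ∨
    ∃ v, [8, v] ∈ S ∧ (∀ h Z, [9, v, h, Z] ∉ S) ∧ r = v :: finish []}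

/-- The algorithm for subtree aggregation in a top tree whose ranks are at most `H`. -/
noncomputable def subtreeAggregation (M H : ℕ) : MPCAlgorithm M where
  rounds := 2 * H + 2
  send t _ x j := write (outgoing join single H t (content x) j)
  -- The last round only turns memory into output. Nodes of rank `1` have answered the leaves in
  -- round `2 * H`.
  update t _ x msg := if t = 2 * H + 1 then write (results join single finish (content x))
    else write (content x ∪ ⋃ j, content (msg j))

end Algorithm

/-! ### What each machine knows before each round, and correctness of the local computations -/

namespace TopTree

open RootedTreeOn

variable {n : ℕ} {T : RootedTreeOn n} {α c : ℝ} (τ : TopTree T α c) {M : ℕ} {Λ : Type*}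
  (l : Sym2 (Fin n) → Λ) (encL : Λ → List ℕ) (home : Fin τ.N → Fin M) (vhome : Fin n → Fin M)
  (code : Finset (Sym2 (Fin n)) → List ℕ) (H : ℕ)

/-- The records of machine `i` before round `t`. -/
inductive Known (t : ℕ) (i : Fin M) : List ℕ → Prop
  | init (r : List ℕ) : τ.IsRecord l encL home vhome i r → Known t i r
  | cov (X Y : Fin τ.N) (a b : Fin n) : home X = i → τ.parent Y = some X → τ.rank Y < t →
      τ.Cov Y a b → Known t i [10, X, Y, a, b]
  | hang (X Y : Fin τ.N) (b : Fin n) : home X = i → τ.parent Y = some X → τ.rank Y < t →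
      τ.Port Y b → Known t i (11 :: (X : ℕ) :: (Y : ℕ) :: (b : ℕ) :: code (τ.hang Y b))
  | below (X P : Fin τ.N) (b : Fin n) : home X = i → τ.parent X = some P →
      2 * H < t + τ.rank X → τ.Port X b →
      Known t i (12 :: (X : ℕ) :: (b : ℕ) :: code (T.subtreeEdges b))

/-- The records that machine `i` sends to machine `j` in round `t`. -/
inductive Sent (t : ℕ) (i j : Fin M) : List ℕ → Prop
  | cov (X P : Fin τ.N) (a b : Fin n) : home X = i → home P = j → τ.parent X = some P →
      τ.rank X = t → τ.Cov X a b → Sent t i j [10, P, X, a, b]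
  | hang (X P : Fin τ.N) (b : Fin n) : home X = i → home P = j → τ.parent X = some P →
      τ.rank X = t → τ.Port X b →
      Sent t i j (11 :: (P : ℕ) :: (X : ℕ) :: (b : ℕ) :: code (τ.hang X b))
  | below (X Y : Fin τ.N) (b : Fin n) : home X = i → home Y = j → τ.parent Y = some X →
      t + τ.rank X = 2 * H + 1 → τ.Port Y b →
      Sent t i j (12 :: (Y : ℕ) :: (b : ℕ) :: code (T.subtreeEdges b))

/-- The final records of machine `i`. -/
inductive Final (finish : List ℕ → List ℕ) (i : Fin M) : List ℕ → Prop
  | edge (X : Fin τ.N) (u : Fin n) : home X = i → τ.rank X = 0 → u ∈ edgeVerts (τ.cluster X) →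
      Final finish i ((u : ℕ) :: finish (code (T.subtreeEdges u)))
  | isolated (v : Fin n) : vhome v = i → T.IsVertex v → (∀ e ∈ T.edges, v ∉ e) →
      Final finish i ((v : ℕ) :: finish (code (T.subtreeEdges v)))

variable {τ l encL home vhome code H} {t : ℕ} {i : Fin M}

variable (τ l encL home vhome code H t i) in
/-- The set of records of machine `i` before round `t`. -/
abbrev KnownSet : Set (List ℕ) := {r | Known τ l encL home vhome code H t i r}

/-- The first word of a record identifies its constructor. This lemma and its analogues below
translate tests on words into statements about nodes and vertices. -/
theorem known_rank {X h : ℕ} : [0, X, h] ∈ KnownSet τ l encL home vhome code H t i ↔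
    ∃ X' : Fin τ.N, home X' = i ∧ X = X' ∧ h = τ.rank X' := by
  constructor
  · intro h
    rw [Set.mem_ofPred_eq] at h
    generalize hr : [0, X, _] = r at h
    rcases h with ⟨r, h⟩ | _ | _ | _
    · cases h <;> simp at hr
      exact ⟨_, ‹_›, hr⟩
    all_goals simp at hr
  · rintro ⟨X, hX, rfl, rfl⟩
    exact .init _ (.rank X hX)

theorem known_parent {X j P : ℕ} : [1, X, j, P] ∈ KnownSet τ l encL home vhome code H t i ↔
    ∃ X' P' : Fin τ.N, home X' = i ∧ τ.parent X' = some P' ∧ X = X' ∧ j = home P' ∧ P = P' := by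
  constructor
  · intro h
    rw [Set.mem_ofPred_eq] at h
    generalize hr : [1, X, _, _] = r at h
    rcases h with ⟨r, h⟩ | _ | _ | _
    · cases h <;> simp at hr
      exact ⟨_, _, ‹_›, ‹_›, hr⟩
    all_goals simp at hr
  · rintro ⟨X, P, hX, hP, rfl, rfl, rfl⟩
    exact .init _ (.parent X P hX hP)

theorem known_root {X b : ℕ} : [2, X, b] ∈ KnownSet τ l encL home vhome code H t i ↔
    ∃ X' : Fin τ.N, home X' = i ∧ X = X' ∧ b = τ.root X' := by
  constructor
  · intro h
    rw [Set.mem_ofPred_eq] at h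
    generalize hr : [2, X, b] = r at h
    rcases h with ⟨r, h⟩ | _ | _ | _
    · cases h <;> simp at hr
      exact ⟨_, ‹_›, hr⟩
    all_goals simp at hr
  · rintro ⟨X, hX, rfl, rfl⟩
    exact .init _ (.root X hX)

theorem known_boundary {X b : ℕ} : [3, X, b] ∈ KnownSet τ l encL home vhome code H t i ↔
    ∃ (X' : Fin τ.N) (b' : Fin n), home X' = i ∧ τ.IsBoundary X' b' ∧ X = X' ∧ b = b' := by
  constructor
  · intro h
    rw [Set.mem_ofPred_eq] at h
    generalize hr : [3, X, b] = r at h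
    rcases h with ⟨r, h⟩ | _ | _ | _
    · cases h <;> simp at hr
      exact ⟨_, _, ‹_›, ‹_›, hr⟩
    all_goals simp at hr
  · rintro ⟨X, b, hX, hb, rfl, rfl⟩
    exact .init _ (.boundary X b hX hb)

theorem known_child {X j Y : ℕ} : [4, X, j, Y] ∈ KnownSet τ l encL home vhome code H t i ↔
    ∃ X' Y' : Fin τ.N, home X' = i ∧ τ.parent Y' = some X' ∧ X = X' ∧ j = home Y' ∧ Y = Y' := by
  constructor
  · intro h
    rw [Set.mem_ofPred_eq] at h
    generalize hr : [4, X, _, _] = r at h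
    rcases h with ⟨r, h⟩ | _ | _ | _
    · cases h <;> simp at hr
      exact ⟨_, _, ‹_›, ‹_›, hr⟩
    all_goals simp at hr
  · rintro ⟨X, P, hX, hP, rfl, rfl, rfl⟩
    exact .init _ (.child X P hX hP)

theorem known_edge {X u v : ℕ} {x : List ℕ} : (6 :: X :: u :: v :: x) ∈ KnownSet τ l encL home vhome code H t i ↔
    ∃ (X' : Fin τ.N) (u' v' : Fin n), home X' = i ∧ τ.rank X' = 0 ∧ τ.cluster X' = {s(u', v')} ∧
      X = X' ∧ u = u' ∧ v = v' ∧ x = encL (l s(u', v')) := by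
  constructor
  · intro h
    rw [Set.mem_ofPred_eq] at h
    generalize hr : 6 :: X :: _ = r at h
    rcases h with ⟨r, h⟩ | _ | _ | _
    · cases h <;> simp at hr
      exact ⟨_, _, _, ‹_›, ‹_›, ‹_›, hr⟩
    all_goals simp at hr
  · rintro ⟨X, u, v, hX, hr, hc, rfl, rfl, rfl, rfl⟩
    exact .init _ (.edge X u v hX hr hc)

theorem known_vertex {v : ℕ} : [8, v] ∈ KnownSet τ l encL home vhome code H t i ↔
    ∃ v' : Fin n, vhome v' = i ∧ T.IsVertex v' ∧ v = v' := by
  constructor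
  · intro h
    rw [Set.mem_ofPred_eq] at h
    generalize hr : [8, v] = r at h
    rcases h with ⟨r, h⟩ | _ | _ | _
    · cases h <;> simp at hr
      exact ⟨_, ‹_›, ‹_›, hr⟩
    all_goals simp at hr
  · rintro ⟨v, hv, hT, rfl⟩
    exact .init _ (.vertex v hv hT)

theorem known_vertexRef {v h Z : ℕ} : [9, v, h, Z] ∈ KnownSet τ l encL home vhome code H t i ↔
    ∃ (v' : Fin n) (Z' : Fin τ.N), vhome v' = i ∧ T.IsVertex v' ∧ Z' ∈ τ.ref v' ∧ v = v' ∧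
      h = home Z' ∧ Z = Z' := by
  constructor
  · intro h
    rw [Set.mem_ofPred_eq] at h
    generalize hr : [9, v, _, _] = r at h
    rcases h with ⟨r, h⟩ | _ | _ | _
    · cases h <;> simp at hr
      exact ⟨_, _, ‹_›, ‹_›, ‹_›, hr⟩
    all_goals simp at hr
  · rintro ⟨v, Z, hv, hT, hZ, rfl, rfl, rfl⟩
    exact .init _ (.vertexRef v Z hv hT hZ)

theorem known_cov {X Y a b : ℕ} : [10, X, Y, a, b] ∈ KnownSet τ l encL home vhome code H t i ↔
    ∃ (X' Y' : Fin τ.N) (a' b' : Fin n), home X' = i ∧ τ.parent Y' = some X' ∧ τ.rank Y' < t ∧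
      τ.Cov Y' a' b' ∧ X = X' ∧ Y = Y' ∧ a = a' ∧ b = b' := by
  constructor
  · intro h
    rw [Set.mem_ofPred_eq] at h
    generalize hr : [10, X, _, _, _] = r at h
    rcases h with ⟨r, h⟩ | _ | _ | _
    · cases h <;> simp at hr
    · simp at hr
      exact ⟨_, _, _, _, ‹_›, ‹_›, ‹_›, ‹_›, hr⟩
    all_goals simp at hr
  · rintro ⟨X, Y, a, b, hX, hY, ht, hc, rfl, rfl, rfl, rfl⟩
    exact .cov X Y a b hX hY ht hc

theorem known_hang {X Y b : ℕ} {x : List ℕ} : (11 :: X :: Y :: b :: x) ∈ KnownSet τ l encL home vhome code H t i ↔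
    ∃ (X' Y' : Fin τ.N) (b' : Fin n), home X' = i ∧ τ.parent Y' = some X' ∧ τ.rank Y' < t ∧
      τ.Port Y' b' ∧ X = X' ∧ Y = Y' ∧ b = b' ∧ x = code (τ.hang Y' b') := by
  constructor
  · intro h
    rw [Set.mem_ofPred_eq] at h
    generalize hr : 11 :: X :: _ = r at h
    rcases h with ⟨r, h⟩ | _ | _ | _
    · cases h <;> simp at hr
    · simp at hr
    · simp at hr
      exact ⟨_, _, _, ‹_›, ‹_›, ‹_›, ‹_›, hr⟩
    · simp at hr
  · rintro ⟨X, Y, b, hX, hY, ht, hc, rfl, rfl, rfl, rfl⟩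
    exact .hang X Y b hX hY ht hc

theorem known_below {X b : ℕ} {x : List ℕ} : (12 :: X :: b :: x) ∈ KnownSet τ l encL home vhome code H t i ↔
    ∃ (X' P' : Fin τ.N) (b' : Fin n), home X' = i ∧ τ.parent X' = some P' ∧
      2 * H < t + τ.rank X' ∧ τ.Port X' b' ∧ X = X' ∧ b = b' ∧
      x = code (T.subtreeEdges b') := by
  constructor
  · intro h
    rw [Set.mem_ofPred_eq] at h
    generalize hr : 12 :: X :: _ = r at h
    rcases h with ⟨r, h⟩ | _ | _ | _
    · cases h <;> simp at hr
    · simp at hr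
    · simp at hr
    · simp at hr
      exact ⟨_, _, _, ‹_›, ‹_›, ‹_›, ‹_›, hr⟩
  · rintro ⟨X, P, b, hX, hP, ht, hc, rfl, rfl, rfl⟩
    exact .below X P b hX hP ht hc

theorem portIn_iff {X : Fin τ.N} (hX : home X = i) {b : ℕ} :
    PortIn (KnownSet τ l encL home vhome code H t i) X b ↔ ∃ b' : Fin n, b = b' ∧ τ.Port X b' := by
  rw [PortIn, known_root, known_boundary]
  constructor
  · rintro (⟨X', -, h, rfl⟩ | ⟨X', b', -, hb, h, rfl⟩)
    · rw [Fin.ext h]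
      exact ⟨_, rfl, Or.inl rfl⟩
    · rw [Fin.ext h]
      exact ⟨_, rfl, Or.inr hb⟩
  · rintro ⟨b, rfl, rfl | hb⟩
    · exact Or.inl ⟨X, hX, rfl, rfl⟩
    · exact Or.inr ⟨X, b, hX, hb, rfl, rfl⟩

theorem leaf_ends {X : Fin τ.N} (hr : τ.rank X = 0) :
    ∃ e ∈ T.edges, τ.cluster X = {e} ∧ τ.root X = T.top e ∧
      τ.cluster X = {s(T.top e, T.bot e)} := by
  obtain ⟨e, he, hX⟩ := τ.leaf_cluster X hr
  refine ⟨e, he, hX, ?_, by rw [hX, ← (ends_spec he).1]⟩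
  have hm : ∀ v ∈ edgeVerts (τ.cluster X), v = T.top e ∨ v = T.bot e := by
    rintro v ⟨e', he', hv⟩
    rw [hX, Finset.mem_singleton] at he'
    exact (mem_edge_iff he).1 (he' ▸ hv)
  refine (hm _ (τ.root_mem X)).resolve_right fun h => ?_
  have := τ.root_ancestor X (T.top e) ⟨e, by simp [hX], top_mem he⟩
  exact (par_ends he).not_isAncestor (h ▸ this)

/-- Each generating pair goes down the tree, which gives one direction. Conversely, `rank X ≤ t`
means that all children have reported their covering relations, and these generate the order of the
hubs; at a leaf the edge itself does. -/
theorem leIn_iff {X : Fin τ.N} (hX : home X = i) (ht : τ.rank X ≤ t) {a b : Fin n}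
    (ha : τ.Hub X a) (hb : τ.Hub X b) : LeIn (KnownSet τ l encL home vhome code H t i) X a b ↔ T.IsAncestor a b := by
  constructor
  · intro h
    have key : ∀ b : ℕ, LeIn (KnownSet τ l encL home vhome code H t i) X a b → ∃ b' : Fin n, b = b' ∧ T.IsAncestor a b' := by
      intro b h
      induction h with
      | refl => exact ⟨a, rfl, isAncestor_refl (isVertex_of_mem ha.mem)⟩
      | tail _ hstep ih =>
        obtain ⟨b', rfl, hab⟩ := ih
        rcases hstep with ⟨Y, hY⟩ | ⟨x, h6, h2⟩
        · obtain ⟨X', Y', a', c', -, -, -, hc, -, -, h1, rfl⟩ := known_cov.1 hY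
          rw [Fin.ext h1] at hab
          exact ⟨c', rfl, hab.trans hc.2.2.1⟩
        · obtain ⟨X', u, v, -, hr, hc, hXX, h1, rfl, -⟩ := known_edge.1 h6
          obtain ⟨X'', -, hXX', h1'⟩ := known_root.1 h2
          rw [← Fin.ext hXX] at hr hc
          rw [← Fin.ext hXX'] at h1'
          rw [← Fin.ext h1] at hc
          refine ⟨v, rfl, hab.trans ?_⟩
          rw [Fin.ext h1']
          exact τ.root_ancestor X v ⟨s(b', v), by rw [hc]; simp, by simp⟩
    obtain ⟨b', hb', h⟩ := key b h
    rwa [Fin.ext hb']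
  · intro h
    rcases Nat.eq_zero_or_pos (τ.rank X) with hr | hr
    · obtain ⟨e, he, hc, hroot, hc'⟩ := leaf_ends hr
      have hm : ∀ v, τ.Hub X v → v = T.top e ∨ v = T.bot e := by
        intro v hv
        obtain ⟨e', he', hv⟩ := hv.mem
        rw [hc, Finset.mem_singleton] at he'
        exact (mem_edge_iff he).1 (he' ▸ hv)
      rcases hm a ha with rfl | rfl <;> rcases hm b hb with rfl | rfl
      · exact .refl
      · exact .single (Or.inr ⟨_, known_edge.2 ⟨X, _, _, hX, hr, hc', rfl, rfl, rfl, rfl⟩,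
          known_root.2 ⟨X, hX, rfl, by rw [hroot]⟩⟩)
      · exact absurd h (par_ends he).not_isAncestor
      · exact .refl
    · refine Relation.ReflTransGen.lift (fun v : Fin n => (v : ℕ)) ?_ _ _
        (ha.reflTransGen_cov hr hb h)
      rintro p q ⟨Y, hY, hc⟩
      have := τ.rank_parent X Y hY
      exact Or.inl ⟨Y, known_cov.2 ⟨X, Y, p, q, hX, hY, by omega, hc, rfl, rfl, rfl, rfl⟩⟩

theorem covIn_iff {X : Fin τ.N} (hX : home X = i) (ht : τ.rank X ≤ t) {a b : ℕ} :
    CovIn (KnownSet τ l encL home vhome code H t i) X a b ↔ ∃ a' b' : Fin n, a = a' ∧ b = b' ∧ τ.Cov X a' b' := by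
  simp only [CovIn, portIn_iff hX]
  constructor
  · rintro ⟨⟨a, rfl, ha⟩, ⟨b, rfl, hb⟩, hab, hne, h⟩
    refine ⟨a, b, rfl, rfl, ha, hb, (leIn_iff hX ht ha.hub hb.hub).1 hab,
      fun h => hne (by rw [h]), fun c hc hac hcb => ?_⟩
    exact (h c ⟨c, rfl, hc⟩ ((leIn_iff hX ht ha.hub hc.hub).2 hac)
      ((leIn_iff hX ht hc.hub hb.hub).2 hcb)).imp Fin.ext Fin.ext
  · rintro ⟨a, b, rfl, rfl, ha, hb, hab, hne, h⟩
    refine ⟨⟨a, rfl, ha⟩, ⟨b, rfl, hb⟩, (leIn_iff hX ht ha.hub hb.hub).2 hab,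
      fun h => hne (Fin.ext h), ?_⟩
    rintro _ ⟨c, rfl, hc⟩ hac hcb
    exact (h c hc ((leIn_iff hX ht ha.hub hc.hub).1 hac)
      ((leIn_iff hX ht hc.hub hb.hub).1 hcb)).imp (by rintro rfl; rfl) (by rintro rfl; rfl)

/-- `single` computes the codes of the edges of the tree. -/
def CodesEdges (T : RootedTreeOn n) (l : Sym2 (Fin n) → Λ) (encL : Λ → List ℕ)
    (code : Finset (Sym2 (Fin n)) → List ℕ) (single : ℕ → ℕ → List ℕ → List ℕ) : Prop :=
  ∀ u v : Fin n, s(u, v) ∈ T.edges → single u v (encL (l s(u, v))) = code {s(u, v)}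

variable {single : ℕ → ℕ → List ℕ → List ℕ} {join : List ℕ → List ℕ → List ℕ}
  {finish : List ℕ → List ℕ}

theorem hang_root_of_leaf {X : Fin τ.N} (hr : τ.rank X = 0) :
    τ.hang X (τ.root X) = τ.cluster X := by
  ext e
  refine ⟨fun h => (mem_hang.1 h).1, fun h => ?_⟩
  obtain ⟨Y, q, hp, he⟩ := exists_piece h
  rcases hp with ⟨hY, -⟩ | ⟨-, rfl, rfl⟩
  · have := rank_pos_of_parent hY
    omega
  · exact he

/-- A leaf records its edge in both orientations, and the root record selects the one with the upper
endpoint first. At inner nodes, pieces are the reports of the children, complete once `rank X ≤ t`.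
-/
theorem pieceIn_iff (hs : CodesEdges T l encL code single) {X : Fin τ.N} (hX : home X = i)
    (ht : τ.rank X ≤ t) {Y q : ℕ} {x : List ℕ} : PieceIn single (KnownSet τ l encL home vhome code H t i) X Y q x ↔
      ∃ (Y' : Fin τ.N) (q' : Fin n), τ.Piece X Y' q' ∧ Y = Y' ∧ q = q' ∧
        x = code (τ.hang Y' q') := by
  constructor
  · rintro (h | ⟨rfl, v, y, h6, h2, rfl⟩)
    · obtain ⟨X', Y', b', -, hY, -, hp, hXX, rfl, rfl, rfl⟩ := known_hang.1 h
      rw [← Fin.ext hXX] at hY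
      exact ⟨Y', b', Or.inl ⟨hY, hp⟩, rfl, rfl, rfl⟩
    · obtain ⟨X', u, v, -, hr, hc, hXX, h1, rfl, rfl⟩ := known_edge.1 h6
      obtain ⟨X'', -, hXX', h1'⟩ := known_root.1 h2
      rw [← Fin.ext hXX] at hr hc
      rw [← Fin.ext hXX'] at h1'
      refine ⟨X, τ.root X, Or.inr ⟨hr, rfl, rfl⟩, rfl, h1', ?_⟩
      rw [hang_root_of_leaf hr, hc, h1]
      exact hs u v (cluster_subset X (by rw [hc]; simp))
  · rintro ⟨Y, q, ⟨hY, hp⟩ | ⟨hr, rfl, rfl⟩, rfl, rfl, rfl⟩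
    · have := τ.rank_parent X Y hY
      exact Or.inl (known_hang.2 ⟨X, Y, q, hX, hY, by omega, hp, rfl, rfl, rfl, rfl⟩)
    · obtain ⟨e, he, hc, hroot, hc'⟩ := leaf_ends hr
      refine Or.inr ⟨rfl, T.bot e, _, known_edge.2 ⟨Y, T.top e, T.bot e, hX, hr, hc', rfl,
        by rw [hroot], rfl, rfl⟩, known_root.2 ⟨Y, hX, rfl, rfl⟩, ?_⟩
      rw [hang_root_of_leaf hr, hc', hroot]
      exact (hs _ _ ((ends_spec he).1 ▸ he)).symm

theorem hangCode_eq (hs : CodesEdges T l encL code single) (hj : JoinsCodes T join code)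
    {X : Fin τ.N} (hX : home X = i) (ht : τ.rank X ≤ t) {b : Fin n} (hb : τ.Port X b) :
    hangCode join single (KnownSet τ l encL home vhome code H t i) X b = code (τ.hang X b) := by
  have htag : Function.Injective fun p : Fin τ.N × Fin n => [(p.1 : ℕ), (p.2 : ℕ)] := by
    rintro ⟨Y, q⟩ ⟨Y', q'⟩ h
    simpa [Fin.ext_iff] using h
  have := hj.combine_eq {p : Fin τ.N × Fin n | τ.Piece X p.1 p.2 ∧ T.IsAncestor b p.2 ∧
    ∀ b', τ.Port X b' → T.IsAncestor b b' → T.IsAncestor b' p.2 → b' = b} htag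
    (A := fun p => τ.hang p.1 p.2) ?_ (U := τ.hang X b) ?_ (hang_subset X b)
  · rw [← this, hangCode]
    congr 1
    ext p
    simp only [Set.mem_ofPred_eq, Prod.exists, pieceIn_iff hs hX ht, portIn_iff hX]
    constructor
    · rintro ⟨_, _, _, ⟨Y, q, hp, rfl, rfl, rfl⟩, rfl, hbq, h⟩
      refine ⟨Y, q, ⟨hp, (leIn_iff hX ht hb.hub hp.hub).1 hbq, fun b' hb' h1 h2 => ?_⟩, rfl⟩
      exact Fin.ext (h b' ⟨b', rfl, hb'⟩ ((leIn_iff hX ht hb.hub hb'.hub).2 h1)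
        ((leIn_iff hX ht hb'.hub hp.hub).2 h2))
    · rintro ⟨Y, q, ⟨hp, hbq, h⟩, rfl⟩
      refine ⟨_, _, _, ⟨Y, q, hp, rfl, rfl, rfl⟩, rfl, (leIn_iff hX ht hb.hub hp.hub).2 hbq, ?_⟩
      rintro _ ⟨b', rfl, hb'⟩ h1 h2
      rw [h b' hb' ((leIn_iff hX ht hb.hub hb'.hub).1 h1)
        ((leIn_iff hX ht hb'.hub hp.hub).1 h2)]
  · rintro ⟨Y, q⟩ h ⟨Y', q'⟩ h' e he he'
    obtain ⟨h1, h2⟩ := piece_unique h.1 h'.1 he he'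
    exact Prod.ext h1 h2
  · intro e
    rw [mem_hang_iff hb.hub]
    simp

/-- The hypothesis `hP` says that the parent of `X`, if any, has already answered, so that the
subtrees of all portals of `X` are known. -/
theorem belowCode_eq (hs : CodesEdges T l encL code single) (hj : JoinsCodes T join code)
    {X : Fin τ.N} (hX : home X = i) (ht : τ.rank X ≤ t)
    (hP : τ.parent X ≠ none → 2 * H < t + τ.rank X) {q : Fin n} (hq : τ.Hub X q) :
    belowCode join single (KnownSet τ l encL home vhome code H t i) X q = code (T.subtreeEdges q) := by
  -- The parentless node receives no answer and needs none, since its cluster is the whole tree: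
  -- there `K` is empty.
  set K : Fin n → Prop := fun b => τ.parent X ≠ none ∧ τ.Port X b with hKdef
  have hK : ∀ b, K b → τ.Port X b := fun b h => h.2
  have h12 : ∀ b x, (12 :: (X : ℕ) :: b :: x) ∈ KnownSet τ l encL home vhome code H t i ↔
      ∃ b' : Fin n, K b' ∧ b = b' ∧ x = code (T.subtreeEdges b') := by
    intro b x
    rw [known_below]
    constructor
    · rintro ⟨X', P, b', -, hP, -, hb, hXX, rfl, rfl⟩
      rw [← Fin.ext hXX] at hP hb
      exact ⟨b', ⟨by simp [hP], hb⟩, rfl, rfl⟩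
    · rintro ⟨b', ⟨hn, hb⟩, rfl, rfl⟩
      obtain ⟨P, hP'⟩ := Option.ne_none_iff_exists'.1 hn
      exact ⟨X, P, b', hX, hP', hP hn, hb, rfl, rfl, rfl⟩
  have hXK : τ.cluster X = T.edges ∨ ∀ b, τ.Port X b → K b := by
    by_cases h : τ.parent X = none
    · exact Or.inl (cluster_eq_edges h)
    · exact Or.inr fun b hb => ⟨h, hb⟩
  -- Pieces get tags of two words and subtrees tags of one word, so the two families cannot be
  -- confused.
  let tag : (Fin τ.N × Fin n) ⊕ Fin n → List ℕ :=
    Sum.elim (fun p => [(p.1 : ℕ), (p.2 : ℕ)]) fun b => [(b : ℕ)]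
  let A : (Fin τ.N × Fin n) ⊕ Fin n → Finset (Sym2 (Fin n)) :=
    Sum.elim (fun p => τ.hang p.1 p.2) fun b => T.subtreeEdges b
  let J : Set ((Fin τ.N × Fin n) ⊕ Fin n) := {j | Sum.elim
    (fun p => τ.Piece X p.1 p.2 ∧ T.IsAncestor q p.2 ∧
      ∀ b, K b → T.IsAncestor q b → ¬ T.IsAncestor b p.2)
    (fun b => K b ∧ T.IsAncestor q b ∧
      ∀ b', K b' → T.IsAncestor q b' → T.IsAncestor b' b → b' = b) j}
  have htag : Function.Injective tag := by
    rintro (⟨Y, q⟩ | b) (⟨Y', q'⟩ | b') h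
    · simpa [tag, Fin.ext_iff] using h
    · simp [tag] at h
    · simp [tag] at h
    · simpa [tag, Fin.ext_iff] using h
  have hlt : ∀ (Y : Fin τ.N) (p b : Fin n) (e), τ.Piece X Y p → e ∈ τ.hang Y p → K b →
      e ∈ T.subtreeEdges b → T.IsAncestor b p := fun Y p b e hp he hb heb =>
    ((hK b hb).hub.isAncestor_top_iff hp he).1 (mem_subtreeEdges.1 heb).2
  -- A piece meeting the subtree of `b` lies below `b`, which membership in `J` forbids. Two
  -- selected portals above a common edge are comparable, hence equal as both are highest.
  have hdisj : ∀ i ∈ J, ∀ j ∈ J, ∀ e, e ∈ A i → e ∈ A j → i = j := by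
    rintro (⟨Y, p⟩ | b) hi (⟨Y', p'⟩ | b') hj e hei hej
    · obtain ⟨h1, h2⟩ := piece_unique hi.1 hj.1 hei hej
      exact congrArg Sum.inl (Prod.ext h1 h2)
    · exact absurd (hlt Y p b' e hi.1 hei hj.1 hej) (hi.2.2 b' hj.1 hj.2.1)
    · exact absurd (hlt Y' p' b e hj.1 hej hi.1 hei) (hj.2.2 b hi.1 hi.2.1)
    · rcases (mem_subtreeEdges.1 hei).2.total (mem_subtreeEdges.1 hej).2 with h | h
      · rw [hj.2.2 b hi.1 hi.2.1 h]
      · rw [hi.2.2 b' hj.1 hj.2.1 h]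
  have := hj.combine_eq J htag hdisj (U := T.subtreeEdges q) ?_ (subtreeEdges_subset q)
  · rw [← this, belowCode]
    congr 1
    ext p
    simp only [Set.mem_union, Set.mem_ofPred_eq, Sum.exists, Prod.exists, pieceIn_iff hs hX ht, h12,
      J, tag, A, Sum.elim_inl, Sum.elim_inr]
    refine or_congr ⟨?_, ?_⟩ ⟨?_, ?_⟩
    · rintro ⟨_, _, _, ⟨Y, a, hp, rfl, rfl, rfl⟩, rfl, hqa, h⟩
      refine ⟨Y, a, ⟨hp, (leIn_iff hX ht hq hp.hub).1 hqa, fun b hb hqb hba => ?_⟩, rfl⟩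
      exact h b _ ⟨b, hb, rfl, rfl⟩ ((leIn_iff hX ht hq hb.2.hub).2 hqb)
        ((leIn_iff hX ht hb.2.hub hp.hub).2 hba)
    · rintro ⟨Y, a, ⟨hp, hqa, h⟩, rfl⟩
      refine ⟨_, _, _, ⟨Y, a, hp, rfl, rfl, rfl⟩, rfl, (leIn_iff hX ht hq hp.hub).2 hqa, ?_⟩
      rintro _ _ ⟨b, hb, rfl, rfl⟩ hqb hba
      exact h b hb ((leIn_iff hX ht hq hb.2.hub).1 hqb)
        ((leIn_iff hX ht hb.2.hub hp.hub).1 hba)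
    · rintro ⟨_, _, ⟨b, hb, rfl, rfl⟩, rfl, hqb, h⟩
      refine ⟨b, ⟨hb, (leIn_iff hX ht hq hb.2.hub).1 hqb, fun b' hb' h1 h2 => ?_⟩, rfl⟩
      exact Fin.ext (h b' _ ⟨b', hb', rfl, rfl⟩ ((leIn_iff hX ht hq hb'.2.hub).2 h1)
        ((leIn_iff hX ht hb'.2.hub hb.2.hub).2 h2))
    · rintro ⟨b, ⟨hb, hqb, h⟩, rfl⟩
      refine ⟨_, _, ⟨b, hb, rfl, rfl⟩, rfl, (leIn_iff hX ht hq hb.2.hub).2 hqb, ?_⟩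
      rintro _ _ ⟨b', hb', rfl, rfl⟩ h1 h2
      rw [h b' hb' ((leIn_iff hX ht hq hb'.2.hub).1 h1)
        ((leIn_iff hX ht hb'.2.hub hb.2.hub).1 h2)]
  · intro e
    rw [mem_subtreeEdges_iff hq hK hXK]
    simp only [Sum.exists, Prod.exists, J, A, Set.mem_ofPred_eq, Sum.elim_inl, Sum.elim_inr]

/-- A node of rank `t` has heard from all children before round `t`. Since ranks are at most `H`,
the answering round `2 * H + 1 - rank X` comes after that, and after the answer from above. The
portals of a child are read off its reported pieces, as the description of `X` does not name the
child's root. -/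
theorem outgoing_eq (hs : CodesEdges T l encL code single) (hj : JoinsCodes T join code)
    (hH : ∀ X : Fin τ.N, τ.rank X ≤ H) (j : Fin M) :
    outgoing join single H t (KnownSet τ l encL home vhome code H t i) j = {r | Sent τ home code H t i j r} := by
  ext r
  constructor
  · rintro (⟨_, _, h0, h1, h⟩ | ⟨_, _, _, _, x, h0, ht, h4, h11, rfl⟩)
    · obtain ⟨X, hX, rfl, rfl⟩ := known_rank.1 h0
      obtain ⟨X', P, -, hP, hXX, hj', rfl⟩ := known_parent.1 h1
      rw [← Fin.ext hXX] at hP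
      have hPj : home P = j := (Fin.ext hj').symm
      rcases h with ⟨_, _, hc, rfl⟩ | ⟨_, hb, rfl⟩
      · obtain ⟨a, b, rfl, rfl, hc'⟩ := (covIn_iff hX le_rfl).1 hc
        exact .cov X P a b hX hPj hP rfl hc'
      · obtain ⟨b, rfl, hb'⟩ := (portIn_iff hX).1 hb
        rw [hangCode_eq hs hj hX le_rfl hb']
        exact .hang X P b hX hPj hP rfl hb'
    · obtain ⟨X, hX, rfl, rfl⟩ := known_rank.1 h0
      obtain ⟨X', Y, -, hY, hXX, hj', rfl⟩ := known_child.1 h4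
      rw [← Fin.ext hXX] at hY
      obtain ⟨X'', Y', q, -, -, -, hp, -, hYY, rfl, -⟩ := known_hang.1 h11
      rw [← Fin.ext hYY] at hp
      have := hH X
      rw [belowCode_eq hs hj hX (by omega) (fun _ => by omega) (Or.inl ⟨Y, hY, hp⟩)]
      exact .below X Y q hX (Fin.ext hj').symm hY ht hp
  · rintro (⟨X, P, a, b, hX, rfl, hP, rfl, hc⟩ | ⟨X, P, b, hX, rfl, hP, rfl, hb⟩ |
      ⟨X, Y, b, hX, rfl, hY, ht, hb⟩)
    · exact Or.inl ⟨X, P, known_rank.2 ⟨X, hX, rfl, rfl⟩,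
        known_parent.2 ⟨X, P, hX, hP, rfl, rfl, rfl⟩,
        Or.inl ⟨a, b, (covIn_iff hX le_rfl).2 ⟨a, b, rfl, rfl, hc⟩, rfl⟩⟩
    · exact Or.inl ⟨X, P, known_rank.2 ⟨X, hX, rfl, rfl⟩,
        known_parent.2 ⟨X, P, hX, hP, rfl, rfl, rfl⟩,
        Or.inr ⟨b, (portIn_iff hX).2 ⟨b, rfl, hb⟩, by rw [hangCode_eq hs hj hX le_rfl hb]⟩⟩
    · have := hH X
      have := τ.rank_parent X Y hY
      refine Or.inr ⟨X, τ.rank X, Y, b, _, known_rank.2 ⟨X, hX, rfl, rfl⟩, ht,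
        known_child.2 ⟨X, Y, hX, hY, rfl, rfl, rfl⟩,
        known_hang.2 ⟨X, Y, b, hX, hY, by omega, hb, rfl, rfl, rfl, rfl⟩, ?_⟩
      rw [belowCode_eq hs hj hX (by omega) (fun _ => by omega) (Or.inl ⟨Y, hY, hb⟩)]

/-- The only new facts come from nodes at the threshold: reports of children of rank `t`, and
answers to `X` with `t + rank X = 2 * H`, whose parent has rank one more and thus sends in round
`t`. -/
theorem known_succ {r : List ℕ} : Known τ l encL home vhome code H (t + 1) i r ↔
    Known τ l encL home vhome code H t i r ∨ ∃ j, Sent τ home code H t j i r := by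
  constructor
  · rintro (⟨r, h⟩ | ⟨X, Y, a, b, hX, hY, ht, h⟩ | ⟨X, Y, b, hX, hY, ht, h⟩ |
      ⟨X, P, b, hX, hP, ht, h⟩)
    · exact Or.inl (.init r h)
    · rcases Nat.lt_succ_iff_lt_or_eq.1 ht with ht | ht
      · exact Or.inl (.cov X Y a b hX hY ht h)
      · exact Or.inr ⟨_, .cov Y X a b rfl hX hY ht h⟩
    · rcases Nat.lt_succ_iff_lt_or_eq.1 ht with ht | ht
      · exact Or.inl (.hang X Y b hX hY ht h)
      · exact Or.inr ⟨_, .hang Y X b rfl hX hY ht h⟩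
    · by_cases ht' : 2 * H < t + τ.rank X
      · exact Or.inl (.below X P b hX hP ht' h)
      · have := τ.rank_parent P X hP
        exact Or.inr ⟨_, .below P X b rfl hX hP (by omega) h⟩
  · rintro ((⟨r, h⟩ | ⟨X, Y, a, b, hX, hY, ht, h⟩ | ⟨X, Y, b, hX, hY, ht, h⟩ |
      ⟨X, P, b, hX, hP, ht, h⟩) | ⟨j, ⟨X, P, a, b, -, hP, hX, rfl, hc⟩ |
      ⟨X, P, b, -, hP, hX, rfl, hb⟩ | ⟨X, Y, b, -, hY, hX, ht, hb⟩⟩)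
    · exact .init r h
    · exact .cov X Y a b hX hY (by omega) h
    · exact .hang X Y b hX hY (by omega) h
    · exact .below X P b hX hP (by omega) h
    · exact .cov P X a b hP hX (by omega) hc
    · exact .hang P X b hP hX (by omega) hb
    · have := τ.rank_parent X Y hX
      exact .below Y X b hY hX (by omega) hb

theorem known_zero (hH : ∀ X : Fin τ.N, τ.rank X ≤ H) {r : List ℕ} :
    Known τ l encL home vhome code H 0 i r ↔ τ.IsRecord l encL home vhome i r := by
  refine ⟨?_, .init r⟩
  rintro (⟨r, h⟩ | ⟨X, Y, a, b, hX, hY, ht, h⟩ | ⟨X, Y, b, hX, hY, ht, h⟩ |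
    ⟨X, P, b, hX, hP, ht, h⟩)
  · exact h
  · omega
  · omega
  · have := hH X
    omega

/-- The two orientations of a leaf's edge record yield both endpoints. A vertex on no edge is
recognised by its empty reference set; its subtree has no edges, so its code is `[]`. -/
theorem results_eq (hs : CodesEdges T l encL code single) (hj : JoinsCodes T join code)
    (ht : 2 * H < t) :
    results join single finish (KnownSet τ l encL home vhome code H t i) = {r | Final τ home vhome code finish i r} := by
  have hempty : ∀ v : Fin n, (∀ e ∈ T.edges, v ∉ e) → code (T.subtreeEdges v) = [] := by
    intro v hv
    rw [← hj.empty]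
    congr 1
    refine Finset.eq_empty_of_forall_notMem fun e he => ?_
    rw [mem_subtreeEdges] at he
    obtain ⟨e', he', h⟩ := he.2.exists_edge ⟨e, he.1, top_mem he.1⟩
    exact hv e' he' h
  ext r
  constructor
  · rintro (⟨_, _, _, _, h6, rfl⟩ | ⟨_, h8, h9, rfl⟩)
    · obtain ⟨X, u, v, hX, hr, hc, rfl, rfl, rfl, rfl⟩ := known_edge.1 h6
      have hu : u ∈ edgeVerts (τ.cluster X) := ⟨s(u, v), by rw [hc]; simp, by simp⟩
      rw [belowCode_eq hs hj hX (by omega) (fun _ => by omega) (Or.inr ⟨hr, hu⟩)]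
      exact .edge X u hX hr hu
    · obtain ⟨v, hv, hT, rfl⟩ := known_vertex.1 h8
      have hiso : ∀ e ∈ T.edges, v ∉ e := by
        intro e he hve
        obtain ⟨X, ⟨-, hc⟩, -⟩ := τ.leaf_unique e he
        obtain ⟨Z, ⟨hZ, -⟩, -⟩ := τ.ref_unique v X ⟨e, by simp [hc], hve⟩
        exact h9 _ _ (known_vertexRef.2 ⟨v, Z, hv, hT, hZ, rfl, rfl, rfl⟩)
      rw [← hempty v hiso]
      exact .isolated v hv hT hiso
  · rintro (⟨X, u, hX, hr, hu⟩ | ⟨v, hv, hT, hiso⟩)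
    · have hb := belowCode_eq hs hj (vhome := vhome) (t := t) (H := H) hX (by omega)
        (fun _ => by omega) (Or.inr ⟨hr, hu⟩)
      rw [← hb]
      obtain ⟨e, he, hue⟩ := hu
      obtain ⟨e', he', hc⟩ := τ.leaf_cluster X hr
      rw [hc, Finset.mem_singleton] at he
      obtain ⟨v, rfl⟩ := Sym2.mem_iff_exists.1 hue
      exact Or.inl ⟨X, u, v, _, known_edge.2 ⟨X, u, v, hX, hr, by rw [hc, he], rfl, rfl, rfl,
        rfl⟩, rfl⟩
    · rw [hempty v hiso]
      refine Or.inr ⟨v, known_vertex.2 ⟨v, hv, hT, rfl⟩, fun h Z h9 => ?_, rfl⟩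
      obtain ⟨v', Z', -, -, hZ, hvv, -, -⟩ := known_vertexRef.1 h9
      rw [← Fin.ext hvv] at hZ
      obtain ⟨e, he, hve⟩ := τ.ref_mem v Z' hZ
      exact hiso e (cluster_subset Z' he) hve

end TopTree

/-! ### Charging records to the initial memory -/

namespace TopTree

open RootedTreeOn

variable {n : ℕ} {T : RootedTreeOn n} {α c : ℝ} {τ : TopTree T α c} {M : ℕ} {Λ : Type*}
  {l : Sym2 (Fin n) → Λ} {encL : Λ → List ℕ} {home : Fin τ.N → Fin M} {vhome : Fin n → Fin M}
  {code : Finset (Sym2 (Fin n)) → List ℕ} {finish : List ℕ → List ℕ} {H t : ℕ} {i : Fin M}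
  {single : ℕ → ℕ → List ℕ → List ℕ} {join : List ℕ → List ℕ → List ℕ}

variable (τ l encL home vhome i) in
/-- The records that machine `i` stores initially. -/
abbrev InitSet : Set (List ℕ) := {r | τ.IsRecord l encL home vhome i r}

variable (τ home) in
/-- The record `a` of the node `X` tells that `b` is a portal of its child `Y`. -/
def ChildOrigin (X Y : Fin τ.N) (b : Fin n) (a : List ℕ) : Prop :=
  (b = τ.root Y ∧ a = [4, (X : ℕ), (home Y : ℕ), (Y : ℕ)]) ∨ a = [5, (X : ℕ), (Y : ℕ), (b : ℕ)]

variable (τ) in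
/-- The record `a` tells that `b` is a portal of the node `X`. -/
def PortOrigin (X : Fin τ.N) (b : Fin n) (a : List ℕ) : Prop :=
  a = [2, (X : ℕ), (b : ℕ)] ∨ a = [3, (X : ℕ), (b : ℕ)]

theorem exists_childOrigin {X Y : Fin τ.N} {b : Fin n} (hX : home X = i)
    (hY : τ.parent Y = some X) (hb : τ.Port Y b) :
    ∃ a ∈ InitSet τ l encL home vhome i, ChildOrigin τ home X Y b a := by
  rcases hb with rfl | hb
  · exact ⟨_, .child X Y hX hY, Or.inl ⟨rfl, rfl⟩⟩
  · exact ⟨_, .childBoundary X Y b hX hY hb, Or.inr rfl⟩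

theorem exists_portOrigin {X : Fin τ.N} {b : Fin n} (hX : home X = i) (hb : τ.Port X b) :
    ∃ a ∈ InitSet τ l encL home vhome i, PortOrigin τ X b a := by
  rcases hb with rfl | hb
  · exact ⟨_, .root X hX, Or.inl rfl⟩
  · exact ⟨_, .boundary X b hX hb, Or.inr rfl⟩

theorem ChildOrigin.unique {X Y X' Y' : Fin τ.N} {b b' : Fin n} {a : List ℕ}
    (h : ChildOrigin τ home X Y b a) (h' : ChildOrigin τ home X' Y' b' a) :
    X = X' ∧ Y = Y' ∧ b = b' := by
  rcases h with ⟨rfl, rfl⟩ | rfl <;> rcases h' with ⟨rfl, h'⟩ | h' <;>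
    simp [Fin.val_inj] at h'
  · obtain ⟨rfl, -, rfl⟩ := h'
    exact ⟨rfl, rfl, rfl⟩
  · exact h'

theorem PortOrigin.unique {X X' : Fin τ.N} {b b' : Fin n} {a : List ℕ}
    (h : PortOrigin τ X b a) (h' : PortOrigin τ X' b' a) : X = X' ∧ b = b' := by
  rcases h with rfl | rfl <;> rcases h' with h' | h' <;> simp [Fin.val_inj] at h' <;> exact h'

/-- Two portals covered by `b` are both ancestors of `b`, hence comparable, and the lower one would
lie strictly between. So a covering pair can be charged to its lower member. -/
theorem Cov.unique {Y : Fin τ.N} {a a' b : Fin n} (h : τ.Cov Y a b) (h' : τ.Cov Y a' b) :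
    a = a' := by
  obtain ⟨ha, -, hab, hne, h⟩ := h
  obtain ⟨ha', -, hab', hne', h'⟩ := h'
  rcases hab.total hab' with haa | haa
  · exact ((h a' ha' haa hab').resolve_right hne').symm
  · exact (h' a ha haa hab).resolve_right hne

theorem IsRecord.headI_lt {r : List ℕ} (h : τ.IsRecord l encL home vhome i r) :
    r.headI < 10 := by
  cases h <;> simp

/-- Each derived record is charged to the initial record that makes its vertex a portal; for the
root of a child this is the child pointer. An initial record is charged at most once per kind, and
there are `13` kinds. -/
theorem ncard_known_le (hfin : (InitSet τ l encL home vhome i).Finite) :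
    (KnownSet τ l encL home vhome code H t i).Finite ∧
      (KnownSet τ l encL home vhome code H t i).ncard ≤
        13 * (InitSet τ l encL home vhome i).ncard := by
  refine ncard_le_of_determined hfin List.headI ?_ (fun a r => (r = a ∧ a.headI < 10) ∨
    (∃ X Y p b, ChildOrigin τ home X Y b a ∧ τ.Cov Y p b ∧ r = [10, (X : ℕ), (Y : ℕ), (p : ℕ), (b : ℕ)]) ∨
    (∃ X Y b, ChildOrigin τ home X Y b a ∧
      r = 11 :: (X : ℕ) :: (Y : ℕ) :: (b : ℕ) :: code (τ.hang Y b)) ∨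
    ∃ X b, PortOrigin τ X b a ∧ r = 12 :: (X : ℕ) :: (b : ℕ) :: code (T.subtreeEdges b)) ?_ ?_
  · rintro r (⟨r, h⟩ | _ | _ | _)
    · exact h.headI_lt.trans (by norm_num)
    all_goals simp
  · rintro r (⟨r, h⟩ | ⟨X, Y, p, b, hX, hY, -, h⟩ | ⟨X, Y, b, hX, hY, -, h⟩ | ⟨X, P, b, hX, -, -, h⟩)
    · exact ⟨r, h, Or.inl ⟨rfl, h.headI_lt⟩⟩
    · obtain ⟨a, ha, ho⟩ := exists_childOrigin (l := l) (encL := encL) (vhome := vhome) hX hY h.2.1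
      exact ⟨a, ha, Or.inr (Or.inl ⟨X, Y, p, b, ho, h, rfl⟩)⟩
    · obtain ⟨a, ha, ho⟩ := exists_childOrigin (l := l) (encL := encL) (vhome := vhome) hX hY h
      exact ⟨a, ha, Or.inr (Or.inr (Or.inl ⟨X, Y, b, ho, rfl⟩))⟩
    · obtain ⟨a, ha, ho⟩ := exists_portOrigin (l := l) (encL := encL) (vhome := vhome) hX h
      exact ⟨a, ha, Or.inr (Or.inr (Or.inr ⟨X, b, ho, rfl⟩))⟩
  · rintro a r r' (⟨rfl, h⟩ | ⟨X, Y, p, b, ho, h, rfl⟩ | ⟨X, Y, b, ho, rfl⟩ | ⟨X, b, ho, rfl⟩)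
      (⟨rfl, h'⟩ | ⟨X', Y', p', b', ho', h', rfl⟩ | ⟨X', Y', b', ho', rfl⟩ | ⟨X', b', ho', rfl⟩)
      hk <;> simp only [List.headI_cons] at hk <;> try omega
    · rfl
    · obtain ⟨rfl, rfl, rfl⟩ := ho.unique ho'
      rw [h.unique h']
    · obtain ⟨rfl, rfl, rfl⟩ := ho.unique ho'
      rfl
    · obtain ⟨rfl, rfl⟩ := ho.unique ho'
      rfl

variable (τ home code H t i) in
/-- The records that machine `i` sends in round `t`. -/
abbrev SentSet : Set (List ℕ) := {r | ∃ j, Sent τ home code H t i j r}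

theorem ncard_sent_le (hfin : (InitSet τ l encL home vhome i).Finite) :
    (SentSet τ home code H t i).Finite ∧
      (SentSet τ home code H t i).ncard ≤ 13 * (InitSet τ l encL home vhome i).ncard := by
  refine ncard_le_of_determined hfin List.headI ?_ (fun a r =>
    (∃ X P p b, PortOrigin τ X b a ∧ τ.parent X = some P ∧ τ.Cov X p b ∧ r = [10, (P : ℕ), (X : ℕ), (p : ℕ), (b : ℕ)]) ∨
    (∃ X P b, PortOrigin τ X b a ∧ τ.parent X = some P ∧
      r = 11 :: (P : ℕ) :: (X : ℕ) :: (b : ℕ) :: code (τ.hang X b)) ∨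
    ∃ X Y b, ChildOrigin τ home X Y b a ∧
      r = 12 :: (Y : ℕ) :: (b : ℕ) :: code (T.subtreeEdges b)) ?_ ?_
  · rintro r ⟨j, _ | _ | _⟩ <;> simp
  · rintro r ⟨j, ⟨X, P, p, b, hX, -, hP, -, h⟩ | ⟨X, P, b, hX, -, hP, -, h⟩ |
      ⟨X, Y, b, hX, -, hY, -, h⟩⟩
    · obtain ⟨a, ha, ho⟩ := exists_portOrigin (l := l) (encL := encL) (vhome := vhome) hX h.2.1
      exact ⟨a, ha, Or.inl ⟨X, P, p, b, ho, hP, h, rfl⟩⟩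
    · obtain ⟨a, ha, ho⟩ := exists_portOrigin (l := l) (encL := encL) (vhome := vhome) hX h
      exact ⟨a, ha, Or.inr (Or.inl ⟨X, P, b, ho, hP, rfl⟩)⟩
    · obtain ⟨a, ha, ho⟩ := exists_childOrigin (l := l) (encL := encL) (vhome := vhome) hX hY h
      exact ⟨a, ha, Or.inr (Or.inr ⟨X, Y, b, ho, rfl⟩)⟩
  · rintro a r r' (⟨X, P, p, b, ho, hP, h, rfl⟩ | ⟨X, P, b, ho, hP, rfl⟩ | ⟨X, Y, b, ho, rfl⟩)
      (⟨X', P', p', b', ho', hP', h', rfl⟩ | ⟨X', P', b', ho', hP', rfl⟩ | ⟨X', Y', b', ho', rfl⟩)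
      hk <;> simp only [List.headI_cons] at hk <;> try omega
    · obtain ⟨rfl, rfl⟩ := ho.unique ho'
      rw [h.unique h', Option.some.inj (hP.symm.trans hP')]
    · obtain ⟨rfl, rfl⟩ := ho.unique ho'
      rw [Option.some.inj (hP.symm.trans hP')]
    · obtain ⟨rfl, rfl, rfl⟩ := ho.unique ho'
      rfl

/-- The sender is the home of a node named in the record, or of that node's parent. Messages from
different machines thus share no record, and lengths can be summed without double counting. -/
theorem Sent.sender_unique {i' j : Fin M} {r : List ℕ} (h : Sent τ home code H t i j r)
    (h' : Sent τ home code H t i' j r) : i = i' := by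
  generalize hr : r = r' at h'
  rcases h with ⟨X, P, p, b, rfl, -, hP, -, h⟩ | ⟨X, P, b, rfl, -, hP, -, h⟩ |
      ⟨X, Y, b, rfl, -, hY, -, h⟩ <;>
    rcases h' with ⟨X', P', p', b', rfl, -, hP', -, h'⟩ | ⟨X', P', b', rfl, -, hP', -, h'⟩ |
      ⟨X', Y', b', rfl, -, hY', -, h'⟩ <;> simp [Fin.val_inj] at hr
  · rw [hr.2.1]
  · rw [hr.2.1]
  · rw [← hr.1, hY] at hY'
    rw [Option.some.inj hY']

theorem Sent.receiver_unique {j j' : Fin M} {r : List ℕ} (h : Sent τ home code H t i j r)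
    (h' : Sent τ home code H t i j' r) : j = j' := by
  generalize hr : r = r' at h'
  rcases h with ⟨X, P, p, b, -, rfl, hP, -, h⟩ | ⟨X, P, b, -, rfl, hP, -, h⟩ |
      ⟨X, Y, b, -, rfl, hY, -, h⟩ <;>
    rcases h' with ⟨X', P', p', b', -, rfl, hP', -, h'⟩ | ⟨X', P', b', -, rfl, hP', -, h'⟩ |
      ⟨X', Y', b', -, rfl, hY', -, h'⟩ <;> simp [Fin.val_inj] at hr
  all_goals rw [hr.1]

variable (τ home vhome code finish i) in
/-- The set of final records of machine `i`. -/
abbrev FinalSet : Set (List ℕ) := {r | Final τ home vhome code finish i r}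

/-- The output for a vertex is charged to a record naming it: the root record of a leaf for the
upper endpoint, an edge record for the lower one, the vertex record if there is no edge. One key
suffices, as such a record determines the vertex. -/
theorem ncard_final_le (hfin : (InitSet τ l encL home vhome i).Finite) :
    (FinalSet τ home vhome code finish i).Finite ∧
      (FinalSet τ home vhome code finish i).ncard ≤
        13 * (InitSet τ l encL home vhome i).ncard := by
  refine ncard_le_of_determined hfin (fun _ => 0) (by simp) (fun a r => ∃ v : Fin n,
    r = (v : ℕ) :: finish (code (T.subtreeEdges v)) ∧ ((∃ x, a = [2, x, (v : ℕ)]) ∨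
      (∃ x u y, a = 6 :: x :: u :: (v : ℕ) :: y) ∨ a = [8, (v : ℕ)])) ?_ ?_
  · rintro r (⟨X, u, hX, hr, hu⟩ | ⟨v, hv, hT, -⟩)
    · obtain ⟨e, he, hc, hroot, hc'⟩ := leaf_ends hr
      obtain ⟨e', he', hu⟩ := hu
      rw [hc, Finset.mem_singleton] at he'
      rcases (mem_edge_iff he).1 (he' ▸ hu) with rfl | rfl
      · exact ⟨_, .root X hX, _, rfl, Or.inl ⟨X, by rw [hroot]⟩⟩
      · exact ⟨_, .edge X _ _ hX hr hc', _, rfl, Or.inr (Or.inl ⟨_, _, _, rfl⟩)⟩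
    · exact ⟨_, .vertex v hv hT, v, rfl, Or.inr (Or.inr rfl)⟩
  · rintro a r r' ⟨v, rfl, ⟨x, rfl⟩ | ⟨x, u, y, rfl⟩ | rfl⟩
      ⟨v', rfl, ⟨x', h⟩ | ⟨x', u', y', h⟩ | h⟩ - <;> simp [Fin.val_inj] at h
    · rw [h.2]
    · rw [h.2.2.1]
    · rw [h]

theorem known_fits {k W : ℕ} (hN : ∀ X : Fin τ.N, (X : ℕ) < W) (hn : n ≤ W) (h13 : 13 ≤ W)
    (hinit : ∀ r, τ.IsRecord l encL home vhome i r → r.length ≤ k + 5 ∧ ∀ w ∈ r, w < W)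
    (hcode : ∀ E ⊆ T.edges, (code E).length ≤ k + 1 ∧ ∀ w ∈ code E, w < W) {r : List ℕ}
    (h : Known τ l encL home vhome code H t i r) : r.length ≤ k + 5 ∧ ∀ w ∈ r, w < W := by
  have hv : ∀ v : Fin n, (v : ℕ) < W := fun v => v.isLt.trans_le hn
  rcases h with ⟨r, h⟩ | ⟨X, Y, p, b, -, -, -, h⟩ | ⟨X, Y, b, -, -, -, h⟩ | ⟨X, P, b, -, -, -, h⟩
  · exact hinit r h
  · refine ⟨by simp, ?_⟩
    simp only [List.forall_mem_cons, hN, hv, true_and]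
    exact ⟨by omega, by simp⟩
  · have hc := hcode _ (hang_subset Y b)
    refine ⟨by simpa using hc.1, ?_⟩
    simp only [List.forall_mem_cons, hN, hv, true_and]
    exact ⟨by omega, hc.2⟩
  · have hc := hcode _ (subtreeEdges_subset (T := T) b)
    refine ⟨by simp only [List.length_cons]; omega, ?_⟩
    simp only [List.forall_mem_cons, hN, hv, true_and]
    exact ⟨by omega, hc.2⟩

theorem IsRecord.length_le {k : ℕ} (hL : ∀ x, (encL x).length = k) {r : List ℕ}
    (h : τ.IsRecord l encL home vhome i r) : r.length ≤ k + 5 := by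
  cases h <;> simp [hL]

/-! ### The run of the algorithm -/

section Run

variable {m : Fin M → List ℕ}

/-- The invariant of the run. Both sending and updating see a memory only through `content`, so the
arbitrary initial order of records is irrelevant. -/
theorem listsRecords_memory (hm : ∀ i, ListsRecords (m i) (InitSet τ l encL home vhome i))
    (hs : CodesEdges T l encL code single) (hj : JoinsCodes T join code)
    (hH : ∀ X : Fin τ.N, τ.rank X ≤ H) (ht : t ≤ 2 * H + 1) (i : Fin M) :
    ListsRecords ((subtreeAggregation join single finish M H).memory m t i)
      (KnownSet τ l encL home vhome code H t i) := by
  induction t generalizing i with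
  | zero =>
    have : KnownSet τ l encL home vhome code H 0 i = InitSet τ l encL home vhome i := by
      ext r
      exact known_zero hH
    rw [this]
    exact hm i
  | succ t ih =>
    have hsent : ∀ j, content (write (outgoing join single H t (content
        ((subtreeAggregation join single finish M H).memory m t j)) i)) =
        {r | Sent τ home code H t j i r} := by
      intro j
      rw [(ih (by omega) j).content_eq, outgoing_eq hs hj hH]
      refine (listsRecords_write ?_).content_eq
      exact (ncard_sent_le (hm j).finite).1.subset fun r hr => ⟨i, hr⟩
    have hmem : (subtreeAggregation join single finish M H).memory m (t + 1) i =
        write (KnownSet τ l encL home vhome code H (t + 1) i) := by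
      simp only [MPCAlgorithm.memory, subtreeAggregation, if_neg (show t ≠ 2 * H + 1 by omega)]
      congr 1
      ext r
      rw [Set.mem_ofPred_eq, known_succ, Set.mem_union, Set.mem_iUnion]
      refine or_congr ?_ (exists_congr fun j => ?_)
      · exact Set.ext_iff.1 (ih (by omega) i).content_eq r
      · exact Set.ext_iff.1 (hsent j) r
    rw [hmem]
    exact listsRecords_write (ncard_known_le (hm i).finite).1

theorem listsRecords_message (hm : ∀ i, ListsRecords (m i) (InitSet τ l encL home vhome i))
    (hs : CodesEdges T l encL code single) (hj : JoinsCodes T join code)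
    (hH : ∀ X : Fin τ.N, τ.rank X ≤ H) (ht : t ≤ 2 * H + 1) (i j : Fin M) :
    ListsRecords ((subtreeAggregation join single finish M H).message m t i j)
      {r | Sent τ home code H t i j r} := by
  have hmem := (listsRecords_memory (finish := finish) hm hs hj hH ht i).content_eq
  have : (subtreeAggregation join single finish M H).message m t i j =
      write {r | Sent τ home code H t i j r} := by
    rw [← outgoing_eq hs hj hH, ← hmem]
    rfl
  rw [this]
  exact listsRecords_write ((ncard_sent_le (hm i).finite).1.subset fun r hr => ⟨j, hr⟩)

theorem listsRecords_final (hm : ∀ i, ListsRecords (m i) (InitSet τ l encL home vhome i))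
    (hs : CodesEdges T l encL code single) (hj : JoinsCodes T join code)
    (hH : ∀ X : Fin τ.N, τ.rank X ≤ H) (i : Fin M) :
    ListsRecords ((subtreeAggregation join single finish M H).memory m (2 * H + 2) i)
      (FinalSet τ home vhome code finish i) := by
  have hmem := (listsRecords_memory (finish := finish) hm hs hj hH le_rfl i).content_eq
  have : (subtreeAggregation join single finish M H).memory m (2 * H + 2) i =
      write (FinalSet τ home vhome code finish i) := by
    rw [FinalSet, ← results_eq (H := H) (t := 2 * H + 1) hs hj (by omega), ← hmem]
    simp [MPCAlgorithm.memory, subtreeAggregation]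
  rw [this]
  exact listsRecords_write (ncard_final_le (hm i).finite).1

/-- The run of the algorithm respects memory bounds that are proportional to the initial
memory. -/
theorem respects_subtreeAggregation {k W : ℕ} {S : ℝ}
    (hm : ∀ i, ListsRecords (m i) (InitSet τ l encL home vhome i))
    (hs : CodesEdges T l encL code single) (hj : JoinsCodes T join code)
    (hH : ∀ X : Fin τ.N, τ.rank X ≤ H) (hL : ∀ x, (encL x).length = k)
    (hcode : ∀ E ⊆ T.edges, (code E).length ≤ k + 1 ∧ ∀ w ∈ code E, w < W)
    (hfinish : ∀ E ⊆ T.edges, (finish (code E)).length ≤ k ∧ ∀ w ∈ finish (code E), w < W)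
    (hmW : ∀ i, ∀ w ∈ m i, w < W) (hn : n ≤ W) (hW : k + 13 ≤ W)
    (hS : ∀ i, (((k + 6) * (13 * (m i).length) : ℕ) : ℝ) ≤ S) :
    (subtreeAggregation join single finish M H).Respects m S W := by
  -- Nothing bounds the number of nodes directly, but each name occurs in a stored rank record.
  have hN : ∀ X : Fin τ.N, (X : ℕ) < W := fun X =>
    (hm (home X)).mem_lt (hmW _) (TopTree.IsRecord.rank X rfl) (w := X) (by simp)
  have hfit : ∀ {t i r}, Known τ l encL home vhome code H t i r →
      r.length + 1 ≤ k + 6 ∧ r.length < W ∧ ∀ w ∈ r, w < W := by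
    intro t i r h
    have := known_fits (k := k) hN hn (by omega) (fun r hr => ⟨hr.length_le hL,
      fun w hw => (hm i).mem_lt (hmW i) hr hw⟩) hcode h
    exact ⟨by omega, by omega, this.2⟩
  have hsk : ∀ {t i j r}, Sent τ home code H t i j r →
      Known τ l encL home vhome code H (t + 1) j r := fun h => known_succ.2 (Or.inr ⟨_, h⟩)
  have hffit : ∀ {i r}, Final τ home vhome code finish i r →
      r.length + 1 ≤ k + 6 ∧ r.length < W ∧ ∀ w ∈ r, w < W := by
    intro i r h
    have key : ∀ v : Fin n, ∀ r, r = (v : ℕ) :: finish (code (T.subtreeEdges v)) →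
        r.length + 1 ≤ k + 6 ∧ r.length < W ∧ ∀ w ∈ r, w < W := by
      rintro v r rfl
      obtain ⟨h1, h2⟩ := hfinish _ (subtreeEdges_subset (T := T) v)
      refine ⟨by simp only [List.length_cons]; omega, by simp only [List.length_cons]; omega, ?_⟩
      rw [List.forall_mem_cons]
      exact ⟨v.isLt.trans_le hn, h2⟩
    rcases h with ⟨X, u, _, _, _⟩ | ⟨v, _, _, _⟩
    · exact key u _ rfl
    · exact key v _ rfl
  have hbound : ∀ {i : Fin M} {x N : ℕ}, x ≤ (k + 6) * N →
      N ≤ 13 * (InitSet τ l encL home vhome i).ncard → (x : ℝ) ≤ S := by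
    intro i x N hx hN
    refine le_trans ?_ (hS i)
    exact_mod_cast hx.trans (Nat.mul_le_mul_left _
      (hN.trans (Nat.mul_le_mul_left _ (hm i).ncard_le)))
  have hlast : ∀ {t}, t ≤ (subtreeAggregation join single finish M H).rounds →
      t ≤ 2 * H + 1 ∨ t = 2 * H + 2 := fun h => by
    change _ ≤ 2 * H + 2 at h
    omega
  have hround : ∀ {t}, t < (subtreeAggregation join single finish M H).rounds →
      t ≤ 2 * H + 1 := fun h => Nat.lt_succ_iff.1 h
  constructor
  · intro t ht i
    rcases hlast ht with ht | rfl
    · exact hbound ((listsRecords_memory hm hs hj hH ht i).length_le fun r hr => (hfit hr).1)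
        (ncard_known_le (hm i).finite).2
    · exact hbound ((listsRecords_final hm hs hj hH i).length_le fun r hr => (hffit hr).1)
        (ncard_final_le (hm i).finite).2
  · intro t ht i
    rcases hlast ht with ht | rfl
    · exact (listsRecords_memory hm hs hj hH ht i).lt fun r hr => (hfit hr).2
    · exact (listsRecords_final hm hs hj hH i).lt fun r hr => (hffit hr).2
  · intro t ht i j
    exact (listsRecords_message hm hs hj hH (hround ht) i j).lt fun r hr => (hfit (hsk hr)).2
  · intro t ht i
    refine hbound (N := ∑ j, {r | Sent τ home code H t i j r}.ncard) ?_
      ((sum_ncard_le (ncard_sent_le (hm i).finite).1 (fun j r hr => ⟨j, hr⟩)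
        fun r j j' h h' => h.receiver_unique h').trans (ncard_sent_le (hm i).finite).2)
    rw [Finset.mul_sum]
    exact Finset.sum_le_sum fun j _ => (listsRecords_message hm hs hj hH (hround ht) i j).length_le
      fun r hr => (hfit (hsk hr)).1
  · intro t ht i
    -- Received records are among those known in the next round, so the memory bound also bounds the
    -- incoming traffic.
    refine hbound (N := ∑ j, {r | Sent τ home code H t j i r}.ncard) ?_
      ((sum_ncard_le (ncard_known_le (t := t + 1) (code := code) (H := H) (hm i).finite).1
        (fun j r hr => hsk hr) fun r j j' h h' => h.sender_unique h').trans
        (ncard_known_le (hm i).finite).2)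
    rw [Finset.mul_sum]
    exact Finset.sum_le_sum fun j _ => (listsRecords_message hm hs hj hH (hround ht) j i).length_le
      fun r hr => (hfit (hsk hr)).1

theorem outputs_subtreeAggregation
    (hm : ∀ i, ListsRecords (m i) (InitSet τ l encL home vhome i))
    (hs : CodesEdges T l encL code single) (hj : JoinsCodes T join code)
    (hH : ∀ X : Fin τ.N, τ.rank X ≤ H) {val : Fin n → List ℕ}
    (hval : ∀ v, finish (code (T.subtreeEdges v)) = val v) :
    (subtreeAggregation join single finish M H).Outputs m T.IsVertex val := by
  choose O hO using listsRecords_final (finish := finish) hm hs hj hH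
  refine ⟨O, fun i => (hO i).2.2, fun v hv => ?_, fun i r hr => ?_⟩
  · by_cases h : ∃ e ∈ T.edges, v ∈ e
    · obtain ⟨e, he, hve⟩ := h
      obtain ⟨X, ⟨hr, hc⟩, -⟩ := τ.leaf_unique e he
      refine ⟨home X, ((hO _).2.1 _).2 ?_⟩
      rw [← hval]
      exact .edge X v rfl hr ⟨e, by simp [hc], hve⟩
    · push Not at h
      refine ⟨vhome v, ((hO _).2.1 _).2 ?_⟩
      rw [← hval]
      exact .isolated v rfl hv h
  · rcases ((hO i).2.1 r).1 hr with ⟨X, u, -, -, hu⟩ | ⟨v, -, hv, -⟩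
    · exact ⟨u, isVertex_of_mem hu, by rw [hval]⟩
    · exact ⟨v, hv, by rw [hval]⟩

end Run

end TopTree

/-! ### Choice of the constants -/

theorem mainTheorem7 :
    ∃ C : ℕ, ∀ (c : ℝ) (B k d : ℕ), ∃ D : ℕ, ∀ (α : ℝ), 0 < α → α < 1 → ∀ (n M : ℕ)
      (Λ : Type*) (β : Type*) (γ : Type*)
      (f : Finset (Sym2 (Fin n) × Λ) → γ) (f' : Finset (Sym2 (Fin n) × Λ) → β)
      (g : β → β → β) (g' : β → γ)
      (encL : Λ → List ℕ) (encB : β → List ℕ) (encC : γ → List ℕ),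
      IsDistributiveAggregative f f' g g' →
      IsWordCode encL Set.univ k ((n + 1) ^ d) →
      IsWordCode encB {b | ∃ l E, IsEdgeSet E ∧ E.Nonempty ∧ b = f' (labelled l E)} k
        ((n + 1) ^ d) →
      IsWordCode encC {b | ∃ l E, IsEdgeSet E ∧ b = f (labelled l E)} k ((n + 1) ^ d) →
      ∃ A : MPCAlgorithm M, (A.rounds : ℝ) ≤ C / α ∧
        ∀ (T : RootedTreeOn n) (l : Sym2 (Fin n) → Λ) (τ : TopTree T α c)
          (home : Fin τ.N → Fin M) (vhome : Fin n → Fin M) (m : Fin M → List ℕ),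
          StoresTopTree τ l encL home vhome m →
          (∀ i, ((m i).length : ℝ) ≤ B * (n : ℝ) ^ α) →
          (∀ i, ∀ w ∈ m i, w < (n + 1) ^ d) →
          A.Respects m (D * (n : ℝ) ^ α) ((n + 1) ^ D) ∧
          A.Outputs m T.IsVertex (fun v => encC (f (labelled l (T.subtreeEdges v)))) := by
  -- With `H = ⌊2 / α⌋₊ + 1` there are `2 * H + 2 ≤ 4 / α + 4 ≤ 8 / α` rounds. In `D`, a record
  -- takes at most `k + 6` words with its length and `13` is the charging factor; the summand `d + k
  -- + 13` makes `(n + 1) ^ D` exceed all words, record kinds and record lengths.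
  refine ⟨8, fun c B k d => ⟨(k + 6) * 13 * B + d + k + 13, fun α hα hα1 n M Λ β γ f f' g g' encL
    encB encC hf hL hB hC => ?_⟩⟩
  obtain ⟨join, hjoin⟩ := exists_join hf hB
  obtain ⟨single, hsingle⟩ := exists_single f' encB hL
  obtain ⟨finish, hfinish⟩ := exists_finish (encC := encC) hf hB
  refine ⟨subtreeAggregation join single finish M (⌊2 / α⌋₊ + 1), ?_, ?_⟩
  · have h1 : (⌊2 / α⌋₊ : ℝ) ≤ 2 / α := Nat.floor_le (by positivity)
    have h2 : 1 ≤ 1 / α := by rw [le_div_iff₀ hα]; linarith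
    have h3 : (8 : ℝ) / α = 2 * (2 / α) + 4 * (1 / α) := by ring
    simp only [subtreeAggregation]
    push_cast
    rw [h3]
    linarith
  intro T l τ home vhome m hm hlen hlt
  generalize hD : (k + 6) * 13 * B + d + k + 13 = D
  have hn : 0 < n := T.root.pos
  have hd : (n + 1) ^ d ≤ (n + 1) ^ D := Nat.pow_le_pow_right (by omega) (by omega)
  have hDW : D < (n + 1) ^ D := Nat.lt_pow_self (by omega)
  have hnW : n ≤ (n + 1) ^ D := (Nat.le_succ n).trans (Nat.le_self_pow (by omega) _)
  have hj : JoinsCodes T join (edgeCode f' encB l) := ⟨edgeCode_empty l, fun E₁ E₂ h₁ h₂ hdisj =>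
    hjoin l E₁ E₂ (RootedTreeOn.isEdgeSet_of_subset h₁) (RootedTreeOn.isEdgeSet_of_subset h₂)
      hdisj⟩
  have hs : TopTree.CodesEdges T l encL (edgeCode f' encB l) single :=
    fun u v _ => hsingle l u v
  have hH : ∀ X : Fin τ.N, τ.rank X ≤ ⌊2 / α⌋₊ + 1 := TopTree.rank_le hα
  refine ⟨TopTree.respects_subtreeAggregation (k := k) hm hs hj hH
    (fun x => hL.length x (Set.mem_univ x)) (fun E hE => ?_) (fun E hE => ?_)
    (fun i w hw => (hlt i w hw).trans_le hd) hnW (by omega) (fun i => ?_),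
    TopTree.outputs_subtreeAggregation hm hs hj hH fun v =>
      hfinish l _ (RootedTreeOn.isEdgeSet_of_subset (RootedTreeOn.subtreeEdges_subset v))⟩
  · have hE' := RootedTreeOn.isEdgeSet_of_subset hE
    exact ⟨length_edgeCode_le hB l hE', edgeCode_lt (by omega) hd hB l hE'⟩
  · have hE' := RootedTreeOn.isEdgeSet_of_subset hE
    rw [hfinish l E hE']
    exact ⟨(hC.length _ ⟨l, E, hE', rfl⟩).le,
      fun w hw => (hC.lt _ ⟨l, E, hE', rfl⟩ w hw).trans_le hd⟩
  · have h0 : (0 : ℝ) ≤ (n : ℝ) ^ α := by positivity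
    have h1 := hlen i
    have h2 : ((k : ℝ) + 6) * 13 * (m i).length ≤ (k + 6) * 13 * (B * (n : ℝ) ^ α) :=
      mul_le_mul_of_nonneg_left h1 (by positivity)
    have h3 : ((k : ℝ) + 6) * 13 * B ≤ D := by
      rw [← hD]
      push_cast
      have : (0 : ℝ) ≤ d := by positivity
      have : (0 : ℝ) ≤ k := by positivity
      linarith
    calc (((k + 6) * (13 * (m i).length) : ℕ) : ℝ) = ((k : ℝ) + 6) * 13 * (m i).length := by
          push_cast; ring
      _ ≤ (k + 6) * 13 * (B * (n : ℝ) ^ α) := h2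
      _ = ((k + 6) * 13 * B) * (n : ℝ) ^ α := by ring
      _ ≤ D * (n : ℝ) ^ α := mul_le_mul_of_nonneg_right h3 h0
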